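/- **Setting.** The finite types are generated from $0$ (natural numbers) by $\sigma\to\tau$ (functionals) and $\sigma^{*}$ (finite sequences of objects of type $\sigma$); $1=0\to0$ and $2=1\to 0$. Terms are built from typed variables and constants by application; the constants are $0$, the successor, the combinators $\Pi,\Sigma$, the recursor $R_{0}$ for recursion of type $0$, and for finite sequences the length $|s|$, the entry $s(i)$ and the sequence $\langle\alpha(0),\dots,\alpha(n-1)\rangle$ formed from $n^{0}$ and $\alpha^{0\to\sigma}$. Formulas are those of classical many-sorted predicate logic with the equality $=_{0}$ and predicates $\mathrm{st}_{\sigma}(x)$ ("$x$ is standard"); $x=_{\sigma\to\tau}y$ abbreviates $(\forall z^{\sigma})(xz=_{\tau}yz)$, $x=_{\sigma^{*}}y$ abbreviates $|x|=_{0}|y|\wedge(\forall i<|x|)(x(i)=_{\sigma}y(i))$, and $q\in w$ abbreviates $(\exists i<|w|)(w(i)=q)$. A formula is internal if it does not contain $\mathrm{st}$; $(\forall^{\rm st}x)$, $(\exists^{\rm st}x)$ are quantifiers restricted to standard objects, and $\varphi^{\rm st}$ is $\varphi$ with all quantifiers so restricted. The system $\mathsf{P}_0$ has the following axioms (free variables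 allowed as parameters). 1. $\mathsf{E\text{-}PRA}^{\omega*}$: reflexivity, symmetry and transitivity of $=_{0}$; extensionality $x=_{\rho}y\to f(x)=_{\tau}f(y)$ at all types; the defining equations of $\Pi,\Sigma,R_{0}$; $Sx\neq0$ and $Sx=Sy\to x=y$; induction for quantifier-free internal formulas; $|\langle\alpha(0),\dots,\alpha(n-1)\rangle|=n$, and $\langle\alpha(0),\dots,\alpha(n-1)\rangle(i)=\alpha(i)$ for $i<n$. 2. $\mathsf{QF\text{-}AC}^{1,0}$: $(\forall f^1)(\exists n^0)\varphi(f,n)\to(\exists Y^2)(\forall f^1)\varphi(f,Y(f))$ for quantifier-free internal $\varphi$. 3. $\mathrm{st}(x)\wedge x=y\to\mathrm{st}(y)$; $\mathrm{st}(t)$ for every closed term $t$; $\mathrm{st}(f)\wedge\mathrm{st}(x)\to\mathrm{st}(f(x))$. 4. Idealisation $\mathsf{I}$: $(\forall^{\rm st}x^{\sigma^*})(\exists y^\tau)(\forall z\in x)\varphi(z,y)\to(\exists y^\tau)(\forall^{\rm st}x^\sigma)\varphi(x,y)$ for internal $\varphi$. 5. $\mathsf{HAC_{int}}$: $(\forall^{\rm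 st}x^\rho)(\exists^{\rm st}y^\tau)\varphi(x,y)\to(\exists^{\rm st}F^{\rho\to\tau^*})(\forall^{\rm st}x^\rho)(\exists y\in F(x))\varphi(x,y)$ for internal $\varphi$. Furthermore, with $Z\approx_2Y$ short for $(\forall^{\rm st}g^1)(Z(g)=_0Y(g))$ and $Y\leq_2 1$ short for $(\forall f^1)(Y(f)\leq_0 1)$, let $$\mathsf{SOT}:\quad(\forall^{\rm st}Y^2)\big[(\exists f^1)(Y(f)=0)\to(\exists^{\rm st}f^1)(Y(f)=0)\big],$$ $$\mathsf{STP}_2:\quad(\forall Y^2\leq_2 1)(\exists^{\rm st}Z^2\leq_2 1)(Z\approx_2Y).$$ A $\Sigma^2_1$-formula is a formula $(\exists Y^2)\theta$ with $\theta$ internal, all of whose quantifiers range over objects of type $0$ or $1$; parameters of arbitrary type are allowed. $\Sigma^2_1\text{-}\mathsf{SEP}$ is the schema consisting of the universal closures (over the parameters) of $$(\forall f^1)(\neg\varphi_1(f)\vee\neg\varphi_2(f))\to(\exists Z^2)(\forall f^1)\big[(\varphi_1(f)\to Z(f)=1)\wedge(\varphi_2(f)\to Z(f)=0)\big]$$ for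 all $\Sigma^2_1$-formulas $\varphi_1,\varphi_2$ not involving $Z$. **Theorem.** The system $\mathsf{P}_0+\mathsf{SOT}+\mathsf{STP}_2$ proves $[\Sigma^2_1\text{-}\mathsf{SEP}]^{\rm st}$, that is, it proves the relativisation to $\mathrm{st}$ of every instance of $\Sigma^2_1\text{-}\mathsf{SEP}$. -/

import Mathlib

namespace NSA

/-! ## Finite types, terms and formulas -/

/-- Finite types: `nat` is the type `0` of natural numbers, `σ ⇒ₜ τ` is the type of functionals
from `σ` to `τ`, and `seq σ` is the type `σ*` of finite sequences of objects of type `σ`. -/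
inductive Ty : Type
  | nat : Ty
  | arrow : Ty → Ty → Ty
  | seq : Ty → Ty

infixr:60 " ⇒ₜ " => Ty.arrow

/-- The type `1` of functions from numbers to numbers. -/
abbrev Ty.one : Ty := Ty.nat ⇒ₜ Ty.nat

/-- The type `2` of functionals mapping type-one objects to numbers. -/
abbrev Ty.two : Ty := Ty.one ⇒ₜ Ty.nat

/-- A context lists the types of the free variables; the most recently bound one comes first. -/
abbrev Ctx : Type := List Ty

/-- (de Bruijn) variables of type `τ` in a context. -/
inductive Var : Ctx → Ty → Type
  | zero {Γ : Ctx} {σ : Ty} : Var (σ :: Γ) σ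
  | succ {Γ : Ctx} {σ τ : Ty} : Var Γ τ → Var (σ :: Γ) τ

/-- The constants: zero, successor, the combinators `Π` (`k`) and `Σ` (`s`), the recursor `R₀`
for recursion of type `0`, and, for finite sequences, the length `|s|`, the entry `s(i)`, and
the sequence `⟨α(0), …, α(n-1)⟩` of length `n` obtained from `n` and `α`. -/
inductive Const : Ty → Type
  | zero : Const Ty.nat
  | succ : Const (Ty.nat ⇒ₜ Ty.nat)
  | k (σ τ : Ty) : Const (σ ⇒ₜ τ ⇒ₜ σ)
  | s (ρ σ τ : Ty) : Const ((ρ ⇒ₜ σ ⇒ₜ τ) ⇒ₜ (ρ ⇒ₜ σ) ⇒ₜ ρ ⇒ₜ τ)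
  | recN : Const (Ty.nat ⇒ₜ Ty.nat ⇒ₜ (Ty.nat ⇒ₜ Ty.nat ⇒ₜ Ty.nat) ⇒ₜ Ty.nat)
  | len (σ : Ty) : Const (Ty.seq σ ⇒ₜ Ty.nat)
  | entry (σ : Ty) : Const (Ty.seq σ ⇒ₜ Ty.nat ⇒ₜ σ)
  | mkSeq (σ : Ty) : Const (Ty.nat ⇒ₜ (Ty.nat ⇒ₜ σ) ⇒ₜ Ty.seq σ)

/-- Terms of each type in a context. -/
inductive Term (Γ : Ctx) : Ty → Type
  | var {τ : Ty} : Var Γ τ → Term Γ τ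
  | con {τ : Ty} : Const τ → Term Γ τ
  | app {σ τ : Ty} : Term Γ (σ ⇒ₜ τ) → Term Γ σ → Term Γ τ

/-- Substitutions of terms over `Δ` for the variables of `Γ`. -/
abbrev Subst (Γ Δ : Ctx) : Type := ∀ τ : Ty, Var Γ τ → Term Δ τ

/-- Simultaneous substitution in a term. -/
def Term.subst {Γ Δ : Ctx} (e : Subst Γ Δ) : {τ : Ty} → Term Γ τ → Term Δ τ
  | _, Term.var x => e _ x
  | _, Term.con c => Term.con c
  | _, Term.app f t => Term.app (Term.subst e f) (Term.subst e t)

/-- The inclusion of a context in the context with one more variable. -/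
def Subst.wk {Γ : Ctx} {σ : Ty} : Subst Γ (σ :: Γ) := fun _ x => Term.var (Var.succ x)

/-- Extend a substitution by a value for one new variable. -/
def Subst.cons {Γ Δ : Ctx} {σ : Ty} (t : Term Δ σ) (e : Subst Γ Δ) : Subst (σ :: Γ) Δ
  | _, Var.zero => t
  | _, Var.succ x => e _ x

/-- The identity substitution. -/
def Subst.id {Γ : Ctx} : Subst Γ Γ := fun _ x => Term.var x

/-- Weakening of a term by one new variable. -/
def Term.wk {Γ : Ctx} {σ τ : Ty} (t : Term Γ τ) : Term (σ :: Γ) τ := t.subst Subst.wk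

/-- Carry a substitution under a binder. -/
def Subst.lift {Γ Δ : Ctx} {σ : Ty} (e : Subst Γ Δ) : Subst (σ :: Γ) (σ :: Δ) :=
  Subst.cons (Term.var Var.zero) (fun _ x => (e _ x).wk)

/-- The only substitution for the empty context. -/
def Subst.empty {Γ : Ctx} : Subst [] Γ := fun _ x => nomatch x

/-- A closed term, read in an arbitrary context. -/
def Term.ofClosed {Γ : Ctx} {τ : Ty} (t : Term [] τ) : Term Γ τ := t.subst Subst.empty

/-- Lambda abstraction, defined from the combinators. -/
def Term.abs {Γ : Ctx} {σ : Ty} : {τ : Ty} → Term (σ :: Γ) τ → Term Γ (σ ⇒ₜ τ)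
  | _, Term.var Var.zero =>
      Term.app (Term.app (Term.con (Const.s σ (σ ⇒ₜ σ) σ)) (Term.con (Const.k σ (σ ⇒ₜ σ))))
        (Term.con (Const.k σ σ))
  | τ, Term.var (Var.succ x) => Term.app (Term.con (Const.k τ σ)) (Term.var x)
  | τ, Term.con c => Term.app (Term.con (Const.k τ σ)) (Term.con c)
  | τ, Term.app (σ := ρ) f t =>
      Term.app (Term.app (Term.con (Const.s σ ρ τ)) (Term.abs f)) (Term.abs t)

section TermAbbreviations

variable {Γ : Ctx}

/-- The most recently bound variable, and the ones bound before it. -/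
abbrev v0 {σ : Ty} : Term (σ :: Γ) σ := Term.var Var.zero
abbrev v1 {σ τ : Ty} : Term (τ :: σ :: Γ) σ := Term.var (Var.succ Var.zero)
abbrev v2 {σ τ ρ : Ty} : Term (ρ :: τ :: σ :: Γ) σ := Term.var (Var.succ (Var.succ Var.zero))

/-- The number `0`. -/
abbrev zeroT : Term Γ Ty.nat := Term.con Const.zero

/-- The successor of a number. -/
abbrev succT (t : Term Γ Ty.nat) : Term Γ Ty.nat := Term.app (Term.con Const.succ) t

/-- The number `1`. -/
abbrev oneT : Term Γ Ty.nat := succT zeroT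

/-- `R₀ n y z`, the recursion with initial value `y` and step `z`. -/
abbrev recT (n y : Term Γ Ty.nat) (z : Term Γ (Ty.nat ⇒ₜ Ty.nat ⇒ₜ Ty.nat)) : Term Γ Ty.nat :=
  Term.app (Term.app (Term.app (Term.con Const.recN) n) y) z

/-- The predecessor of a number (with predecessor `0` for `0`). -/
def predT (t : Term Γ Ty.nat) : Term Γ Ty.nat := recT t zeroT (Term.abs (Term.abs v0))

/-- Truncated subtraction of numbers. -/
def monusT (s t : Term Γ Ty.nat) : Term Γ Ty.nat := recT t s (Term.abs (Term.abs (predT v1)))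

/-- The length `|w|` of a finite sequence. -/
abbrev lenT {σ : Ty} (w : Term Γ (Ty.seq σ)) : Term Γ Ty.nat := Term.app (Term.con (Const.len σ)) w

/-- The entry `w(i)` of a finite sequence. -/
abbrev entryT {σ : Ty} (w : Term Γ (Ty.seq σ)) (i : Term Γ Ty.nat) : Term Γ σ :=
  Term.app (Term.app (Term.con (Const.entry σ)) w) i

/-- The finite sequence `⟨α(0), …, α(n-1)⟩`. -/
abbrev mkSeqT {σ : Ty} (n : Term Γ Ty.nat) (a : Term Γ (Ty.nat ⇒ₜ σ)) : Term Γ (Ty.seq σ) :=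
  Term.app (Term.app (Term.con (Const.mkSeq σ)) n) a

end TermAbbreviations

/-- Formulas of the language with the standardness predicates `st`.  The only primitive equality
is `=₀`.  The logic is classical, and the other connectives are defined below. -/
inductive Formula : Ctx → Type
  | eq0 {Γ : Ctx} : Term Γ Ty.nat → Term Γ Ty.nat → Formula Γ
  | st {Γ : Ctx} {τ : Ty} : Term Γ τ → Formula Γ
  | fal {Γ : Ctx} : Formula Γ
  | imp {Γ : Ctx} : Formula Γ → Formula Γ → Formula Γ
  | all {Γ : Ctx} (σ : Ty) : Formula (σ :: Γ) → Formula Γ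

infixr:50 " ⇒ₚ " => Formula.imp

namespace Formula

/-- Simultaneous substitution in a formula. -/
def subst : {Γ Δ : Ctx} → Subst Γ Δ → Formula Γ → Formula Δ
  | _, _, e, eq0 s t => eq0 (s.subst e) (t.subst e)
  | _, _, e, st t => st (t.subst e)
  | _, _, _, fal => fal
  | _, _, e, imp φ ψ => imp (subst e φ) (subst e ψ)
  | _, _, e, all σ φ => all σ (subst e.lift φ)

/-- Weakening of a formula by one new variable. -/
def wk {Γ : Ctx} {σ : Ty} (φ : Formula Γ) : Formula (σ :: Γ) := φ.subst Subst.wk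

/-- The instance of a formula at a term substituted for the last bound variable. -/
def inst {Γ : Ctx} {σ : Ty} (φ : Formula (σ :: Γ)) (t : Term Γ σ) : Formula Γ :=
  φ.subst (Subst.cons t Subst.id)

section Connectives

variable {Γ : Ctx}

def neg (φ : Formula Γ) : Formula Γ := φ ⇒ₚ fal
def or (φ ψ : Formula Γ) : Formula Γ := neg φ ⇒ₚ ψ
def and (φ ψ : Formula Γ) : Formula Γ := neg (φ ⇒ₚ neg ψ)
def ex (σ : Ty) (φ : Formula (σ :: Γ)) : Formula Γ := neg (all σ (neg φ))

/-- `(∀ˢᵗ x) φ`. -/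
def allSt (σ : Ty) (φ : Formula (σ :: Γ)) : Formula Γ := all σ (st v0 ⇒ₚ φ)

/-- `(∃ˢᵗ x) φ`. -/
def exSt (σ : Ty) (φ : Formula (σ :: Γ)) : Formula Γ := ex σ (and (st v0) φ)

/-- `s ≤₀ t`. -/
def le (s t : Term Γ Ty.nat) : Formula Γ := eq0 (monusT s t) zeroT

/-- `s <₀ t`. -/
def lt (s t : Term Γ Ty.nat) : Formula Γ := le (succT s) t

end Connectives

/-- Equality at all types: pointwise at function types, and at sequence types equality of the
lengths and of the entries. -/
def eq : (τ : Ty) → {Γ : Ctx} → Term Γ τ → Term Γ τ → Formula Γ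
  | Ty.nat, _, s, t => eq0 s t
  | Ty.arrow σ τ, _, s, t => all σ (eq τ (Term.app s.wk v0) (Term.app t.wk v0))
  | Ty.seq σ, _, s, t =>
      and (eq0 (lenT s) (lenT t))
        (all Ty.nat (lt v0 (lenT s.wk) ⇒ₚ eq σ (entryT s.wk v0) (entryT t.wk v0)))

/-- Membership `q ∈ w` in a finite sequence, that is, `(∃ i < |w|) (w(i) = q)`. -/
def mem {Γ : Ctx} {σ : Ty} (q : Term Γ σ) (w : Term Γ (Ty.seq σ)) : Formula Γ :=
  ex Ty.nat (and (lt v0 (lenT w.wk)) (eq σ (entryT w.wk v0) q.wk))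

/-- Internal formulas: those without the predicate `st`. -/
def Internal : {Γ : Ctx} → Formula Γ → Prop
  | _, eq0 _ _ => True
  | _, st _ => False
  | _, fal => True
  | _, imp φ ψ => Internal φ ∧ Internal ψ
  | _, all _ φ => Internal φ

/-- (Internal) quantifier-free formulas. -/
def QuantifierFree : {Γ : Ctx} → Formula Γ → Prop
  | _, eq0 _ _ => True
  | _, st _ => False
  | _, fal => True
  | _, imp φ ψ => QuantifierFree φ ∧ QuantifierFree ψ
  | _, all _ _ => False

/-- Internal formulas all of whose quantifiers range over objects of type `0` or `1`; parameters
of all types are allowed. -/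
def LowerQuantifiers : {Γ : Ctx} → Formula Γ → Prop
  | _, eq0 _ _ => True
  | _, st _ => False
  | _, fal => True
  | _, imp φ ψ => LowerQuantifiers φ ∧ LowerQuantifiers ψ
  | _, all σ φ => (σ = Ty.nat ∨ σ = Ty.one) ∧ LowerQuantifiers φ

/-- `Σ²₁`-formulas: an existential quantifier over objects of type `2` in front of an internal
formula with quantifiers over objects of type `0` and `1` only. -/
def IsSigma21 {Γ : Ctx} (φ : Formula Γ) : Prop :=
  ∃ θ : Formula (Ty.two :: Γ), LowerQuantifiers θ ∧ φ = ex Ty.two θ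

/-- The relativisation `φˢᵗ`: every quantifier is restricted to standard objects. -/
def relSt : {Γ : Ctx} → Formula Γ → Formula Γ
  | _, eq0 s t => eq0 s t
  | _, st t => st t
  | _, fal => fal
  | _, imp φ ψ => imp (relSt φ) (relSt ψ)
  | _, all σ φ => allSt σ (relSt φ)

/-- The universal closure of a formula. -/
def closure : (Γ : Ctx) → Formula Γ → Formula []
  | [], φ => φ
  | σ :: Γ, φ => closure Γ (all σ φ)

end Formula

/-! ## Derivability -/

/-- Natural deduction for classical many-sorted predicate logic, with non-logical axioms `Ax`.
`Derives Ax Γ H φ` says that `φ` is derivable from the hypotheses `H`, where `Γ` lists the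
variables that may occur free. -/
inductive Derives (Ax : (Γ : Ctx) → Formula Γ → Prop) :
    (Γ : Ctx) → List (Formula Γ) → Formula Γ → Prop
  | ax {Γ : Ctx} {H : List (Formula Γ)} {φ : Formula Γ} : Ax Γ φ → Derives Ax Γ H φ
  | hyp {Γ : Ctx} {H : List (Formula Γ)} {φ : Formula Γ} : φ ∈ H → Derives Ax Γ H φ
  | impI {Γ : Ctx} {H : List (Formula Γ)} {φ ψ : Formula Γ} :
      Derives Ax Γ (φ :: H) ψ → Derives Ax Γ H (φ ⇒ₚ ψ)
  | impE {Γ : Ctx} {H : List (Formula Γ)} {φ ψ : Formula Γ} :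
      Derives Ax Γ H (φ ⇒ₚ ψ) → Derives Ax Γ H φ → Derives Ax Γ H ψ
  | raa {Γ : Ctx} {H : List (Formula Γ)} {φ : Formula Γ} :
      Derives Ax Γ (φ.neg :: H) Formula.fal → Derives Ax Γ H φ
  | allI {Γ : Ctx} {H : List (Formula Γ)} {σ : Ty} {φ : Formula (σ :: Γ)} :
      Derives Ax (σ :: Γ) (H.map Formula.wk) φ → Derives Ax Γ H (Formula.all σ φ)
  | allE {Γ : Ctx} {H : List (Formula Γ)} {σ : Ty} {φ : Formula (σ :: Γ)} (t : Term Γ σ) :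
      Derives Ax Γ H (Formula.all σ φ) → Derives Ax Γ H (φ.inst t)

/-! ## The axioms -/

open Formula in
/-- The axioms of `E-PRA^{ω*}`: arithmetic in all finite types with recursion of type `0`,
quantifier-free induction and full extensionality, together with finite sequences.
Here and below axioms may have free variables, which act as universally quantified parameters. -/
inductive EPRAAxiom : (Γ : Ctx) → Formula Γ → Prop
  | refl {Γ : Ctx} (x : Term Γ Ty.nat) : EPRAAxiom Γ (eq0 x x)
  | symm {Γ : Ctx} (x y : Term Γ Ty.nat) : EPRAAxiom Γ (eq0 x y ⇒ₚ eq0 y x)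
  | trans {Γ : Ctx} (x y z : Term Γ Ty.nat) : EPRAAxiom Γ (eq0 x y ⇒ₚ eq0 y z ⇒ₚ eq0 x z)
  | ext {Γ : Ctx} (ρ τ : Ty) (f : Term Γ (ρ ⇒ₜ τ)) (x y : Term Γ ρ) :
      EPRAAxiom Γ (eq ρ x y ⇒ₚ eq τ (Term.app f x) (Term.app f y))
  | k {Γ : Ctx} (σ τ : Ty) (x : Term Γ σ) (y : Term Γ τ) :
      EPRAAxiom Γ (eq σ (Term.app (Term.app (Term.con (Const.k σ τ)) x) y) x)
  | s {Γ : Ctx} (ρ σ τ : Ty) (x : Term Γ (ρ ⇒ₜ σ ⇒ₜ τ)) (y : Term Γ (ρ ⇒ₜ σ)) (z : Term Γ ρ) :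
      EPRAAxiom Γ (eq τ (Term.app (Term.app (Term.app (Term.con (Const.s ρ σ τ)) x) y) z)
        (Term.app (Term.app x z) (Term.app y z)))
  | succ_ne_zero {Γ : Ctx} (x : Term Γ Ty.nat) : EPRAAxiom Γ (neg (eq0 (succT x) zeroT))
  | succ_inj {Γ : Ctx} (x y : Term Γ Ty.nat) :
      EPRAAxiom Γ (eq0 (succT x) (succT y) ⇒ₚ eq0 x y)
  | rec_zero {Γ : Ctx} (y : Term Γ Ty.nat) (z : Term Γ (Ty.nat ⇒ₜ Ty.nat ⇒ₜ Ty.nat)) :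
      EPRAAxiom Γ (eq0 (recT zeroT y z) y)
  | rec_succ {Γ : Ctx} (x y : Term Γ Ty.nat) (z : Term Γ (Ty.nat ⇒ₜ Ty.nat ⇒ₜ Ty.nat)) :
      EPRAAxiom Γ (eq0 (recT (succT x) y z) (Term.app (Term.app z (recT x y z)) x))
  | induction {Γ : Ctx} (φ : Formula (Ty.nat :: Γ)) : φ.QuantifierFree →
      EPRAAxiom Γ (φ.inst zeroT ⇒ₚ
        all Ty.nat (φ ⇒ₚ φ.subst (Subst.cons (succT v0) Subst.wk)) ⇒ₚ all Ty.nat φ)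
  | len_mkSeq {Γ : Ctx} (σ : Ty) (n : Term Γ Ty.nat) (a : Term Γ (Ty.nat ⇒ₜ σ)) :
      EPRAAxiom Γ (eq0 (lenT (mkSeqT n a)) n)
  | entry_mkSeq {Γ : Ctx} (σ : Ty) (n i : Term Γ Ty.nat) (a : Term Γ (Ty.nat ⇒ₜ σ)) :
      EPRAAxiom Γ (lt i n ⇒ₚ eq σ (entryT (mkSeqT n a) i) (Term.app a i))

open Formula in
/-- The axioms of the system `P₀`: those of `E-PRA^{ω*}`, the axiom of choice `QF-AC^{1,0}`, the
basic axioms for `st`, Idealisation `I`, and the Herbrandised axiom of choice `HAC_int`. -/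
inductive P0Axiom : (Γ : Ctx) → Formula Γ → Prop
  | epra {Γ : Ctx} (φ : Formula Γ) : EPRAAxiom Γ φ → P0Axiom Γ φ
  /-- `(∀ f¹)(∃ n⁰) φ(f, n) → (∃ Y²)(∀ f¹) φ(f, Y(f))` for quantifier-free `φ`. -/
  | qfAC {Γ : Ctx} (φ : Formula (Ty.nat :: Ty.one :: Γ)) : φ.QuantifierFree →
      P0Axiom Γ (all Ty.one (ex Ty.nat φ) ⇒ₚ
        ex Ty.two (all Ty.one (φ.subst
          (Subst.cons (Term.app v1 v0) (Subst.cons v0 (fun _ x => (Term.var x).wk.wk))))))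
  | st_eq {Γ : Ctx} (σ : Ty) (x y : Term Γ σ) : P0Axiom Γ (st x ⇒ₚ eq σ x y ⇒ₚ st y)
  | st_closed {Γ : Ctx} (σ : Ty) (t : Term [] σ) : P0Axiom Γ (st t.ofClosed)
  | st_app {Γ : Ctx} (σ τ : Ty) (f : Term Γ (σ ⇒ₜ τ)) (x : Term Γ σ) :
      P0Axiom Γ (st f ⇒ₚ st x ⇒ₚ st (Term.app f x))
  /-- `(∀ˢᵗ x^{σ*})(∃ y^τ)(∀ z^σ ∈ x) φ(z, y) → (∃ y^τ)(∀ˢᵗ x^σ) φ(x, y)` for internal `φ`. -/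
  | idealisation {Γ : Ctx} (σ τ : Ty) (φ : Formula (σ :: τ :: Γ)) : φ.Internal →
      P0Axiom Γ (allSt (Ty.seq σ) (ex τ (all σ (mem v0 v2 ⇒ₚ φ.subst Subst.wk.lift.lift))) ⇒ₚ
        ex τ (allSt σ φ))
  /-- `(∀ˢᵗ x^ρ)(∃ˢᵗ y^τ) φ(x, y) → (∃ˢᵗ F^{ρ → τ*})(∀ˢᵗ x^ρ)(∃ y^τ ∈ F(x)) φ(x, y)` for
  internal `φ`. -/
  | hacInt {Γ : Ctx} (ρ τ : Ty) (φ : Formula (τ :: ρ :: Γ)) : φ.Internal →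
      P0Axiom Γ (allSt ρ (exSt τ φ) ⇒ₚ
        exSt (ρ ⇒ₜ Ty.seq τ) (allSt ρ (ex τ
          (and (mem v0 (Term.app v2 v1)) (φ.subst Subst.wk.lift.lift)))))

open Formula in
/-- `SOT`: `(∀ˢᵗ Y²)[(∃ f¹)(Y(f) = 0) → (∃ˢᵗ f¹)(Y(f) = 0)]`. -/
def SOT : Formula [] :=
  allSt Ty.two (ex Ty.one (eq0 (Term.app v1 v0) zeroT) ⇒ₚ
    exSt Ty.one (eq0 (Term.app v1 v0) zeroT))

/-- `Y ≤₂ 1`, that is, `(∀ f¹)(Y(f) ≤₀ 1)`. -/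
def leOne2 {Γ : Ctx} (Y : Term Γ Ty.two) : Formula Γ :=
  Formula.all Ty.one (Formula.le (Term.app Y.wk v0) oneT)

/-- `Z ≈₂ Y`, that is, `(∀ˢᵗ g¹)(Z(g) =₀ Y(g))`. -/
def approx2 {Γ : Ctx} (Z Y : Term Γ Ty.two) : Formula Γ :=
  Formula.allSt Ty.one (Formula.eq0 (Term.app Z.wk v0) (Term.app Y.wk v0))

open Formula in
/-- `STP₂`: `(∀ Y² ≤₂ 1)(∃ˢᵗ Z² ≤₂ 1)(Z ≈₂ Y)`. -/
def STP2 : Formula [] :=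
  all Ty.two (leOne2 v0 ⇒ₚ exSt Ty.two (and (leOne2 v0) (approx2 v0 v1)))

open Formula in
/-- The instance of separation for `φ₁(f¹)` and `φ₂(f¹)`:
`(∀ f)(¬φ₁(f) ∨ ¬φ₂(f)) → (∃ Z²)(∀ f)[(φ₁(f) → Z(f) = 1) ∧ (φ₂(f) → Z(f) = 0)]`. -/
def separation {Γ : Ctx} (φ₁ φ₂ : Formula (Ty.one :: Γ)) : Formula Γ :=
  all Ty.one (or (neg φ₁) (neg φ₂)) ⇒ₚ
    ex Ty.two (all Ty.one (and
      (φ₁.subst Subst.wk.lift ⇒ₚ eq0 (Term.app v1 v0) oneT)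
      (φ₂.subst Subst.wk.lift ⇒ₚ eq0 (Term.app v1 v0) zeroT)))

end NSA

namespace NSA

/-! ## Substitution -/

/-! By completeness it suffices to argue in a model of `P₀` satisfying `SOT` and `STP2`. The defined
equality is a congruence respecting `st`, so one may pass to a quotient where it is identity. The
syntax is countable, and a Henkin construction along growing finite contexts yields
`derives_of_forall_isModel`.

In such a model `SOT` is transfer for standard `Y²`: a standard `Y` vanishing at all standard `f¹`
vanishes everywhere (`forall_eq_zero_of_forall_st`). Together with `HAC_int` this eliminates
quantifiers. For standard `E` there is a standard `F` such that, for standard `x`, the finite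
sequence `F(x)` contains a counterexample to `∀ f, E(x, f) = 0` if there is one; searching `F(x)`
decides the quantifier by a standard functional (`exists_st_forall`). The variables of types 0, 1
and 2 are coded in one sequence of type-two objects, parameters of other types being kept as
constants. Induction on formulas then gives a standard functional deciding each relativised matrix
(`exists_st_decision`). With the witness coded into the argument, each `φᵢˢᵗ` holds at a standard
`f` iff `f` is the image under a standard `P` of a standard zero of some standard `Eᵢ`
(`exists_st_sigma21`).

It remains to separate two such projections (`exists_st_separation`). For a standard finite sequence
`w`, the characteristic function of the points `P(w(i))` with `E₁(w(i)) = 0` separates correctly on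
the entries of `w`; equality of type-one objects is replaced by a standard functional deciding it on
standard arguments. Idealisation merges these finite solutions into one `Y ≤ 1` correct at all
standard points, and `STP2` replaces `Y` by a standard `Z` with the same values at standard
arguments, which are the only ones the relativised conclusion mentions. -/

/-- Composition of substitutions. -/
def Subst.comp {Γ Δ Θ : Ctx} (e : Subst Γ Δ) (e' : Subst Δ Θ) : Subst Γ Θ :=
  fun τ x => (e τ x).subst e'

theorem Term.subst_subst {Γ Δ Θ : Ctx} (e : Subst Γ Δ) (e' : Subst Δ Θ) {τ : Ty}
    (t : Term Γ τ) : (t.subst e).subst e' = t.subst (e.comp e') := by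
  induction t with
  | var x => rfl
  | con c => rfl
  | app f t hf ht => simp only [Term.subst, hf, ht]

theorem Term.subst_id {Γ : Ctx} {τ : Ty} (t : Term Γ τ) : t.subst Subst.id = t := by
  induction t with
  | var x => rfl
  | con c => rfl
  | app f t hf ht => simp only [Term.subst, hf, ht]

theorem Subst.lift_comp {Γ Δ Θ : Ctx} {σ : Ty} (e : Subst Γ Δ) (e' : Subst Δ Θ) :
    (e.lift (σ := σ)).comp e'.lift = (e.comp e').lift := by
  funext τ x
  cases x with
  | zero => rfl
  | succ x =>
    change ((e _ x).subst Subst.wk).subst _ = ((e _ x).subst e').subst Subst.wk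
    rw [Term.subst_subst, Term.subst_subst]
    rfl

theorem Subst.lift_comp_cons {Γ Δ Θ : Ctx} {σ : Ty} (e : Subst Γ Δ) (e' : Subst Δ Θ)
    (t : Term Θ σ) : (e.lift (σ := σ)).comp (Subst.cons t e') = Subst.cons t (e.comp e') := by
  funext τ x
  cases x with
  | zero => rfl
  | succ x =>
    change ((e _ x).subst Subst.wk).subst _ = (e _ x).subst e'
    rw [Term.subst_subst]
    rfl

theorem Subst.comp_id {Γ Δ : Ctx} (e : Subst Γ Δ) : e.comp Subst.id = e := by
  funext τ x
  exact Term.subst_id _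

theorem Formula.subst_subst {Γ Δ Θ : Ctx} (e : Subst Γ Δ) (e' : Subst Δ Θ) (φ : Formula Γ) :
    (φ.subst e).subst e' = φ.subst (e.comp e') := by
  induction φ generalizing Δ Θ with
  | eq0 s t => simp only [Formula.subst, Term.subst_subst]
  | st t => simp only [Formula.subst, Term.subst_subst]
  | fal => rfl
  | imp φ ψ hφ hψ => simp only [Formula.subst, hφ, hψ]
  | all σ φ ih => simp only [Formula.subst, ih, Subst.lift_comp]

theorem Subst.lift_id {Γ : Ctx} {σ : Ty} : (Subst.id (Γ := Γ)).lift (σ := σ) = Subst.id := by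
  funext τ x
  cases x <;> rfl

theorem Formula.subst_id {Γ : Ctx} (φ : Formula Γ) : φ.subst Subst.id = φ := by
  induction φ with
  | eq0 s t => simp only [Formula.subst, Term.subst_id]
  | st t => simp only [Formula.subst, Term.subst_id]
  | fal => rfl
  | imp φ ψ hφ hψ => simp only [Formula.subst, hφ, hψ]
  | all σ φ ih => simp only [Formula.subst, ih, Subst.lift_id]

/-! ## Countability of the syntax -/

/-- Nesting depth of a type. -/
def Ty.depth : Ty → ℕ
  | Ty.nat => 0
  | Ty.arrow σ τ => max σ.depth τ.depth + 1
  | Ty.seq σ => σ.depth + 1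

/-- Countability of the syntax is what allows the Henkin tasks to be enumerated in order type `ω`.
Each depth bound leaves countably many objects, and the same stratification serves for terms and
formulas. -/
instance Ty.countable : Countable Ty := by
  have key : ∀ n : ℕ, {τ : Ty | τ.depth ≤ n}.Countable := by
    intro n
    induction n with
    | zero =>
      refine (Set.countable_singleton Ty.nat).mono fun τ hτ => ?_
      cases τ <;> simp [Ty.depth] at hτ ⊢
    | succ n ih =>
      refine (((Set.countable_singleton Ty.nat).union (ih.image2 ih Ty.arrow)).union
        (ih.image Ty.seq)).mono fun τ hτ => ?_
      cases τ with
      | nat => simp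
      | arrow σ τ =>
        simp only [Ty.depth, Set.mem_ofPred_eq, add_le_add_iff_right, sup_le_iff] at hτ
        exact Or.inl (Or.inr ⟨σ, hτ.1, τ, hτ.2, rfl⟩)
      | seq σ =>
        simp only [Ty.depth, Set.mem_ofPred_eq, add_le_add_iff_right] at hτ
        exact Or.inr ⟨σ, hτ, rfl⟩
  rw [← Set.countable_univ_iff]
  exact (Set.countable_iUnion key).mono fun τ _ => Set.mem_iUnion.2 ⟨τ.depth, le_refl τ.depth⟩

/-- The position of a variable. -/
def Var.index : {Γ : Ctx} → {τ : Ty} → Var Γ τ → ℕ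
  | _, _, Var.zero => 0
  | _, _, Var.succ x => x.index + 1

theorem Var.index_injective {Γ : Ctx} {τ : Ty} :
    Function.Injective (Var.index : Var Γ τ → ℕ) := by
  intro x
  induction x with
  | zero => intro y h; cases y with
    | zero => rfl
    | succ y => simp [Var.index] at h
  | succ x ih => intro y h; cases y with
    | zero => simp [Var.index] at h
    | succ y => rw [ih (Nat.succ_injective h)]

instance Var.countable {Γ : Ctx} {τ : Ty} : Countable (Var Γ τ) :=
  Var.index_injective.countable

/-- An injective code for the constants. -/
def Const.code : {τ : Ty} → Const τ → ℕ × Ty × Ty × Ty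
  | _, Const.zero => (0, Ty.nat, Ty.nat, Ty.nat)
  | _, Const.succ => (1, Ty.nat, Ty.nat, Ty.nat)
  | _, Const.k σ τ => (2, σ, τ, Ty.nat)
  | _, Const.s ρ σ τ => (3, ρ, σ, τ)
  | _, Const.recN => (4, Ty.nat, Ty.nat, Ty.nat)
  | _, Const.len σ => (5, σ, Ty.nat, Ty.nat)
  | _, Const.entry σ => (6, σ, Ty.nat, Ty.nat)
  | _, Const.mkSeq σ => (7, σ, Ty.nat, Ty.nat)

/-- Phrased in the sigma type because case analysis on both constants meets pairs of different
types. -/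
theorem Const.code_injective {τ τ' : Ty} (c : Const τ) (c' : Const τ') (h : c.code = c'.code) :
    (⟨τ, c⟩ : Σ τ, Const τ) = ⟨τ', c'⟩ := by
  cases c <;> cases c' <;> simp [Const.code] at h ⊢ <;> aesop

instance Const.countable {τ : Ty} : Countable (Const τ) :=
  Function.Injective.countable (f := Const.code) fun c c' h => by
    simpa using Const.code_injective c c' h

/-- Nesting depth of a term. -/
def Term.depth {Γ : Ctx} : {τ : Ty} → Term Γ τ → ℕ
  | _, Term.var _ => 0
  | _, Term.con _ => 0
  | _, Term.app f t => max f.depth t.depth + 1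

/-- The induction on depth covers all types at once: the argument type of an application is not
determined by its result type, so a countable union over types is taken. -/
instance Term.countable {Γ : Ctx} {τ : Ty} : Countable (Term Γ τ) := by
  have key : ∀ (n : ℕ) (τ : Ty), {t : Term Γ τ | t.depth ≤ n}.Countable := by
    intro n
    induction n with
    | zero =>
      intro τ
      refine ((Set.countable_range (Term.var (Γ := Γ) (τ := τ))).union
        (Set.countable_range (Term.con (Γ := Γ) (τ := τ)))).mono fun t ht => ?_
      cases t <;> simp [Term.depth] at ht ⊢
    | succ n ih =>
      intro τ
      refine (((Set.countable_range (Term.var (Γ := Γ) (τ := τ))).union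
        (Set.countable_range (Term.con (Γ := Γ) (τ := τ)))).union
        (Set.countable_iUnion fun σ : Ty => (ih (σ ⇒ₜ τ)).image2 (ih σ) Term.app)).mono
        fun t ht => ?_
      cases t with
      | var x => simp
      | con c => simp
      | app f t =>
        simp only [Term.depth, Set.mem_ofPred_eq, add_le_add_iff_right, sup_le_iff] at ht
        exact Or.inr (Set.mem_iUnion.2 ⟨_, f, ht.1, t, ht.2, rfl⟩)
  rw [← Set.countable_univ_iff]
  exact (Set.countable_iUnion fun n => key n τ).mono
    fun t _ => Set.mem_iUnion.2 ⟨t.depth, le_refl t.depth⟩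

/-- Nesting depth of a formula. -/
def Formula.depth : {Γ : Ctx} → Formula Γ → ℕ
  | _, Formula.eq0 _ _ => 0
  | _, Formula.st _ => 0
  | _, Formula.fal => 0
  | _, Formula.imp φ ψ => max φ.depth ψ.depth + 1
  | _, Formula.all _ φ => φ.depth + 1

instance Formula.countable {Γ : Ctx} : Countable (Formula Γ) := by
  have atoms : ∀ Γ : Ctx, (Set.range (fun p : Term Γ Ty.nat × Term Γ Ty.nat =>
      Formula.eq0 p.1 p.2) ∪ Set.range (fun p : Σ τ, Term Γ τ => Formula.st p.2) ∪
      {Formula.fal}).Countable := fun Γ =>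
    ((Set.countable_range _).union (Set.countable_range _)).union (Set.countable_singleton _)
  have key : ∀ (n : ℕ) (Γ : Ctx), {φ : Formula Γ | φ.depth ≤ n}.Countable := by
    intro n
    induction n with
    | zero =>
      intro Γ
      refine (atoms Γ).mono fun φ hφ => ?_
      cases φ with
      | eq0 s t => exact Or.inl (Or.inl ⟨(s, t), rfl⟩)
      | st t => exact Or.inl (Or.inr ⟨⟨_, t⟩, rfl⟩)
      | fal => exact Or.inr rfl
      | imp φ ψ => simp [Formula.depth] at hφ
      | all σ φ => simp [Formula.depth] at hφ
    | succ n ih =>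
      intro Γ
      refine (((atoms Γ).union ((ih Γ).image2 (ih Γ) Formula.imp)).union
        (Set.countable_iUnion fun σ : Ty => (ih (σ :: Γ)).image (Formula.all σ))).mono
        fun φ hφ => ?_
      cases φ with
      | eq0 s t => exact Or.inl (Or.inl (Or.inl (Or.inl ⟨(s, t), rfl⟩)))
      | st t => exact Or.inl (Or.inl (Or.inl (Or.inr ⟨⟨_, t⟩, rfl⟩)))
      | fal => exact Or.inl (Or.inl (Or.inr rfl))
      | imp φ ψ =>
        simp only [Formula.depth, Set.mem_ofPred_eq, add_le_add_iff_right, sup_le_iff] at hφ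
        exact Or.inl (Or.inr ⟨φ, hφ.1, ψ, hφ.2, rfl⟩)
      | all σ φ =>
        simp only [Formula.depth, Set.mem_ofPred_eq, add_le_add_iff_right] at hφ
        exact Or.inr (Set.mem_iUnion.2 ⟨σ, φ, hφ, rfl⟩)
  rw [← Set.countable_univ_iff]
  exact (Set.countable_iUnion fun n => key n Γ).mono
    fun φ _ => Set.mem_iUnion.2 ⟨φ.depth, le_refl φ.depth⟩

/-- A closed term of each type. -/
def Ty.defaultTerm {Γ : Ctx} : (τ : Ty) → Term Γ τ
  | Ty.nat => Term.con Const.zero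
  | Ty.arrow σ τ => Term.app (Term.con (Const.k τ σ)) τ.defaultTerm
  | Ty.seq σ => Term.app (Term.app (Term.con (Const.mkSeq σ)) (Term.con Const.zero))
      (Term.app (Term.con (Const.k σ Ty.nat)) σ.defaultTerm)

end NSA

namespace NSA

/-! ## Semantics -/

/-- Structures for the language, in which `=₀` is an arbitrary binary relation. -/
structure PreModel where
  C : Ty → Type
  app : {σ τ : Ty} → C (σ ⇒ₜ τ) → C σ → C τ
  con : {τ : Ty} → Const τ → C τ
  st : {τ : Ty} → C τ → Prop
  eq0 : C Ty.nat → C Ty.nat → Prop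

/-- Assignments of objects to the variables of a context. -/
abbrev PreModel.Env (M : PreModel) (Γ : Ctx) : Type := ∀ τ : Ty, Var Γ τ → M.C τ

namespace PreModel

variable {M : PreModel} {Γ Δ : Ctx}

/-- The assignment for the empty context. -/
def Env.nil : M.Env [] := fun _ x => nomatch x

/-- Extend an assignment by a value for one new variable. -/
def Env.cons {σ : Ty} (a : M.C σ) (e : M.Env Γ) : M.Env (σ :: Γ)
  | _, Var.zero => a
  | _, Var.succ x => e _ x

/-- The value of a term. -/
def eval (e : M.Env Γ) : {τ : Ty} → Term Γ τ → M.C τ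
  | _, Term.var x => e _ x
  | _, Term.con c => M.con c
  | _, Term.app f t => M.app (eval e f) (eval e t)

/-- Satisfaction of a formula. -/
def Sat : {Γ : Ctx} → M.Env Γ → Formula Γ → Prop
  | _, e, Formula.eq0 s t => M.eq0 (eval e s) (eval e t)
  | _, e, Formula.st t => M.st (eval e t)
  | _, _, Formula.fal => False
  | _, e, Formula.imp φ ψ => Sat e φ → Sat e ψ
  | _, e, Formula.all σ φ => ∀ a : M.C σ, Sat (Env.cons a e) φ

end PreModel

/-! ## Derivations -/

variable {Ax : (Γ : Ctx) → Formula Γ → Prop}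

theorem Derives.mono {Γ : Ctx} {H H' : List (Formula Γ)} {φ : Formula Γ}
    (h : Derives Ax Γ H φ) (hH : H ⊆ H') : Derives Ax Γ H' φ := by
  induction h with
  | ax h => exact .ax h
  | hyp h => exact .hyp (hH h)
  | impI _ ih => exact .impI (ih (List.cons_subset_cons _ hH))
  | impE _ _ ih₁ ih₂ => exact .impE (ih₁ hH) (ih₂ hH)
  | raa _ ih => exact .raa (ih (List.cons_subset_cons _ hH))
  | allI _ ih => exact .allI (ih (List.map_subset _ hH))
  | allE t _ ih => exact .allE t (ih hH)

theorem Derives.closure {Γ : Ctx} {φ : Formula Γ} (h : Derives Ax Γ [] φ) :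
    Derives Ax [] [] (Formula.closure Γ φ) := by
  induction Γ with
  | nil => exact h
  | cons σ Γ ih => exact ih (.allI h)

variable (Ax) in
/-- No contradiction follows from a set of formulas. -/
def Consistent {Γ : Ctx} (T : Set (Formula Γ)) : Prop :=
  ∀ L : List (Formula Γ), (∀ ψ ∈ L, ψ ∈ T) → ¬ Derives Ax Γ L Formula.fal

variable (Ax) in
/-- Maximal consistent sets of formulas. -/
def MaximalConsistent {Γ : Ctx} (T : Set (Formula Γ)) : Prop :=
  Consistent Ax T ∧ ∀ φ, φ ∈ T ∨ φ.neg ∈ T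

/-- Hypotheses from `insert φ T` can be sorted into `φ` and hypotheses from `T`. -/
theorem exists_list_of_insert {α : Type*} {T : Set α} {a : α} (L : List α)
    (hL : ∀ b ∈ L, b ∈ insert a T) : ∃ L' : List α, (∀ b ∈ L', b ∈ T) ∧ L ⊆ a :: L' := by
  classical
  refine ⟨L.filter (· ≠ a), fun b hb => ?_, fun b hb => ?_⟩
  · simp only [List.mem_filter, decide_eq_true_eq] at hb
    exact (hL b hb.1).resolve_left hb.2
  · by_cases h : b = a
    · simp [h]
    · simp [h, hb]

/-- Zorn's lemma applies because a derivation uses finitely many hypotheses, which all lie in one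
member of a chain. If a maximal set omitted both `φ` and its negation, it would refute each of them,
and the two refutations together would refute the set. -/
theorem MaximalConsistent.exists_extension {Γ : Ctx} {T : Set (Formula Γ)}
    (hT : Consistent Ax T) : ∃ T', T ⊆ T' ∧ MaximalConsistent Ax T' := by
  obtain ⟨T', hTT', hmax⟩ := zorn_subset_nonempty {S : Set (Formula Γ) | Consistent Ax S}
    (fun c hc hchain hne => ⟨⋃₀ c, fun L hL hd => by
      have : ∃ S ∈ c, ∀ ψ ∈ L, ψ ∈ S := by
        clear hd
        induction L with
        | nil => exact ⟨hne.some, hne.some_mem, by simp⟩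
        | cons φ L ih =>
          obtain ⟨S, hS, hLS⟩ := ih fun ψ hψ => hL ψ (List.mem_cons_of_mem _ hψ)
          obtain ⟨S', hS', hφ⟩ := hL φ List.mem_cons_self
          rcases hchain.total hS hS' with h | h
          · exact ⟨S', hS', List.forall_mem_cons.2 ⟨hφ, fun ψ hψ => h (hLS ψ hψ)⟩⟩
          · exact ⟨S, hS, List.forall_mem_cons.2 ⟨h hφ, hLS⟩⟩
      obtain ⟨S, hS, hLS⟩ := this
      exact hc hS L hLS hd, fun S hS => Set.subset_sUnion_of_mem hS⟩) T hT
  refine ⟨T', hTT', hmax.prop, fun φ => ?_⟩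
  by_contra! hφ
  have key : ∀ ψ, ψ ∉ T' → ∃ L, (∀ χ ∈ L, χ ∈ T') ∧ Derives Ax Γ (ψ :: L) Formula.fal := by
    intro ψ hψ
    have : ¬ Consistent Ax (insert ψ T') := fun hc =>
      hψ (hmax.le_of_ge hc (Set.subset_insert _ _) (Set.mem_insert _ _))
    simp only [Consistent, not_forall, not_not] at this
    obtain ⟨L, hL, hd⟩ := this
    obtain ⟨L', hL', hsub⟩ := exists_list_of_insert L hL
    exact ⟨L', hL', hd.mono hsub⟩
  obtain ⟨L₁, hL₁, hd₁⟩ := key _ hφ.1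
  obtain ⟨L₂, hL₂, hd₂⟩ := key _ hφ.2
  refine hmax.prop (L₁ ++ L₂) (fun χ hχ => ?_)
    (.impE (.mono (.impI hd₁) (List.subset_append_left _ _))
      (.mono (.raa hd₂) (List.subset_append_right _ _)))
  rcases List.mem_append.1 hχ with h | h
  exacts [hL₁ χ h, hL₂ χ h]

namespace MaximalConsistent

variable {Γ : Ctx} {T : Set (Formula Γ)} (hT : MaximalConsistent Ax T)
include hT

theorem mem_of_derives {L : List (Formula Γ)} {φ : Formula Γ} (hL : ∀ ψ ∈ L, ψ ∈ T)
    (h : Derives Ax Γ L φ) : φ ∈ T :=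
  (hT.2 φ).resolve_right fun hn => hT.1 (φ.neg :: L) (List.forall_mem_cons.2 ⟨hn, hL⟩)
    (.impE (.hyp List.mem_cons_self) (h.mono (List.subset_cons_self _ _)))

theorem fal_notMem : Formula.fal ∉ T := fun h =>
  hT.1 [Formula.fal] (by simpa using h) (.hyp List.mem_cons_self)

theorem imp_mem_iff {φ ψ : Formula Γ} : (φ ⇒ₚ ψ) ∈ T ↔ (φ ∈ T → ψ ∈ T) := by
  refine ⟨fun h hφ => hT.mem_of_derives (L := [φ ⇒ₚ ψ, φ]) (by simp [h, hφ])
    (.impE (φ := φ) (.hyp (by simp)) (.hyp (by simp))), fun h => ?_⟩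
  rcases hT.2 φ with hφ | hφ
  · exact hT.mem_of_derives (L := [ψ]) (by simp [h hφ]) (.impI (.hyp (by simp)))
  · exact hT.mem_of_derives (L := [φ.neg]) (by simp [hφ])
      (.impI (.raa (.impE (φ := φ) (.hyp (by simp [Formula.neg])) (.hyp (by simp)))))

theorem neg_mem_iff {φ : Formula Γ} : φ.neg ∈ T ↔ φ ∉ T := by
  rw [Formula.neg, hT.imp_mem_iff]
  exact imp_congr_right fun _ => iff_of_false hT.fal_notMem not_false

theorem inst_mem {σ : Ty} {φ : Formula (σ :: Γ)} (h : Formula.all σ φ ∈ T) (t : Term Γ σ) :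
    φ.inst t ∈ T :=
  hT.mem_of_derives (L := [Formula.all σ φ]) (by simpa using h) (.allE t (.hyp (by simp)))

/-- Every type has a closed term, so no domain is empty. -/
theorem all_fal_notMem {σ : Ty} : Formula.all σ Formula.fal ∉ T := fun h =>
  hT.fal_notMem (hT.inst_mem h σ.defaultTerm)

/-- A counterexample to an underivable universal formula may be added as a new variable. -/
theorem exists_counterexample {σ : Ty} {χ : Formula (σ :: Γ)} (hχ : Formula.all σ χ ∉ T) :
    ∃ T' : Set (Formula (σ :: Γ)), MaximalConsistent Ax T' ∧ χ ∉ T' ∧ ∀ φ ∈ T, φ.wk ∈ T' := by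
  have hc : Consistent Ax (insert χ.neg (Formula.wk '' T)) := by
    intro L hL hd
    obtain ⟨L', hL', hsub⟩ := exists_list_of_insert L hL
    obtain ⟨L₀, hL₀, rfl⟩ : ∃ L₀ : List (Formula Γ), (∀ ψ ∈ L₀, ψ ∈ T) ∧
        L₀.map Formula.wk = L' := by
      clear hsub
      induction L' with
      | nil => exact ⟨[], by simp, rfl⟩
      | cons φ L' ih =>
        obtain ⟨L₀, hL₀, rfl⟩ := ih fun ψ hψ => hL' ψ (List.mem_cons_of_mem _ hψ)
        obtain ⟨φ₀, hφ₀, rfl⟩ := hL' φ List.mem_cons_self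
        exact ⟨φ₀ :: L₀, List.forall_mem_cons.2 ⟨hφ₀, hL₀⟩, rfl⟩
    -- The weakened hypotheses do not mention the new variable, so refuting `¬χ` from them proves `∀
    -- χ`.
    exact hχ (hT.mem_of_derives hL₀ (.allI (.raa (hd.mono hsub))))
  obtain ⟨T', hsub, hT'⟩ := exists_extension hc
  exact ⟨T', hT', hT'.neg_mem_iff.1 (hsub (Set.mem_insert _ _)),
    fun φ hφ => hsub (Set.mem_insert_of_mem _ ⟨φ, hφ, rfl⟩)⟩

end MaximalConsistent

/-! ## The Henkin construction -/

/-- An enumeration of all formulas with a distinguished variable, with infinite repetition. -/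
theorem exists_enumeration : ∃ g : ℕ → Σ (Δ : Ctx) (σ : Ty), Formula (σ :: Δ),
    ∀ p (m : ℕ), ∃ n, m ≤ n ∧ g n = p := by
  have : Nonempty (Σ (Δ : Ctx) (σ : Ty), Formula (σ :: Δ)) := ⟨⟨[], Ty.nat, Formula.fal⟩⟩
  obtain ⟨g, hg⟩ := exists_surjective_nat (Σ (Δ : Ctx) (σ : Ty), Formula (σ :: Δ))
  refine ⟨fun n => g n.unpair.1, fun p m => ?_⟩
  obtain ⟨k, rfl⟩ := hg p
  exact ⟨Nat.pair k m, Nat.right_le_pair _ _, by simp⟩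

/-- The enumeration used in the Henkin construction. -/
noncomputable def henkinTask : ℕ → Σ (Δ : Ctx) (σ : Ty), Formula (σ :: Δ) :=
  exists_enumeration.choose

/-- The type of the variable added at each level. -/
noncomputable def henkinType (n : ℕ) : Ty := (henkinTask n).2.1

/-- The context of the variables added up to a level. -/
noncomputable def henkinCtx : ℕ → Ctx
  | 0 => []
  | n + 1 => henkinType n :: henkinCtx n

theorem henkinCtx_length (n : ℕ) : (henkinCtx n).length = n := by
  induction n with
  | zero => rfl
  | succ n ih => simp [henkinCtx, ih]

theorem henkinCtx_injective : Function.Injective henkinCtx := fun m n h => by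
  rw [← henkinCtx_length m, h, henkinCtx_length]

/-- The inclusion of a level in a later one. -/
noncomputable def henkinUp {m n : ℕ} (h : m ≤ n) : Subst (henkinCtx m) (henkinCtx n) :=
  Nat.leRec (motive := fun k _ => Subst (henkinCtx m) (henkinCtx k)) Subst.id
    (fun _ _ e => e.comp Subst.wk) h

theorem henkinUp_refl (m : ℕ) : henkinUp (le_refl m) = Subst.id := by
  simp [henkinUp]

theorem henkinUp_succ {m n : ℕ} (h : m ≤ n) :
    henkinUp (Nat.le_succ_of_le h) = (henkinUp h).comp Subst.wk := by
  rw [henkinUp, Nat.leRec_succ]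
  rfl

theorem henkinUp_trans {l m n : ℕ} (h : l ≤ m) (h' : m ≤ n) :
    (henkinUp h).comp (henkinUp h') = henkinUp (h.trans h') := by
  induction n, h' using Nat.le_induction with
  | base => rw [henkinUp_refl, Subst.comp_id]
  | succ n h' ih =>
    rw [henkinUp_succ h', henkinUp_succ (h.trans h'), ← ih]
    funext τ x
    exact (Term.subst_subst _ _ _).symm

theorem Term.subst_henkinUp_refl {n : ℕ} {τ : Ty} (t : Term (henkinCtx n) τ) :
    t.subst (henkinUp (le_refl n)) = t := by
  rw [henkinUp_refl, Term.subst_id]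

theorem Term.subst_henkinUp_henkinUp {l m n : ℕ} (h : l ≤ m) (h' : m ≤ n) {τ : Ty}
    (t : Term (henkinCtx l) τ) :
    (t.subst (henkinUp h)).subst (henkinUp h') = t.subst (henkinUp (h.trans h')) := by
  rw [Term.subst_subst, henkinUp_trans]

open Classical in
/-- The formula for which the variable added at each level is to be a counterexample. -/
noncomputable def henkinFormula (n : ℕ) : Formula (henkinType n :: henkinCtx n) :=
  if h : ∃ (m : ℕ) (_ : m ≤ n) (φ : Formula (henkinType n :: henkinCtx m)),
      henkinTask n = ⟨henkinCtx m, henkinType n, φ⟩ then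
    h.choose_spec.choose_spec.choose.subst (henkinUp h.choose_spec.choose).lift
  else Formula.fal

/-- Infinite repetition makes the task for `φ` occur at some level `n ≥ m`, to which `φ` can be
lifted. The choice inside `henkinFormula` is harmless: contexts of different levels have different
lengths, so the task determines `m` and `φ`. -/
theorem exists_henkinFormula_eq {m : ℕ} {σ : Ty} (φ : Formula (σ :: henkinCtx m)) :
    ∃ (n : ℕ) (h : m ≤ n) (hσ : σ = henkinType n),
      henkinFormula n = (hσ ▸ φ).subst (henkinUp h).lift := by
  obtain ⟨n, hmn, hn⟩ := exists_enumeration.choose_spec ⟨henkinCtx m, σ, φ⟩ m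
  change henkinTask n = _ at hn
  have hσ : σ = henkinType n := by rw [henkinType, hn]
  refine ⟨n, hmn, hσ, ?_⟩
  subst hσ
  have h : ∃ (m : ℕ) (_ : m ≤ n) (φ : Formula (henkinType n :: henkinCtx m)),
      henkinTask n = ⟨henkinCtx m, henkinType n, φ⟩ := ⟨m, hmn, φ, hn⟩
  rw [henkinFormula, dif_pos h]
  have key : ∀ (m' : ℕ) (h' : m' ≤ n) (φ' : Formula (henkinType n :: henkinCtx m')),
      henkinTask n = ⟨henkinCtx m', henkinType n, φ'⟩ →
      φ'.subst (henkinUp h').lift = φ.subst (henkinUp hmn).lift := by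
    intro m' h' φ' h''
    rw [hn] at h''
    obtain rfl : m = m' := henkinCtx_injective (congrArg Sigma.fst h'')
    simp only [Sigma.mk.injEq, heq_eq_eq, true_and] at h''
    rw [h'']
  exact key _ h.choose_spec.choose _ h.choose_spec.choose_spec.choose_spec

variable (Ax) in
/-- A chain of maximal consistent sets with counterexamples. -/
structure HenkinTheory where
  T : (n : ℕ) → Set (Formula (henkinCtx n))
  maximal : ∀ n, MaximalConsistent Ax (T n)
  wk_mem : ∀ n, ∀ φ ∈ T n, (φ.wk : Formula (henkinCtx (n + 1))) ∈ T (n + 1)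
  counterexample : ∀ n, Formula.all (henkinType n) (henkinFormula n) ∉ T n →
    (henkinFormula n : Formula (henkinCtx (n + 1))) ∉ T (n + 1)

theorem HenkinTheory.exists_of_consistent {T₀ : Set (Formula [])} (h₀ : Consistent Ax T₀) :
    ∃ 𝒯 : HenkinTheory Ax, T₀ ⊆ 𝒯.T 0 := by
  classical
  obtain ⟨T', hT₀, hT'⟩ := MaximalConsistent.exists_extension h₀
  have step : ∀ (n : ℕ) (S : {S : Set (Formula (henkinCtx n)) // MaximalConsistent Ax S}),
      ∃ S' : {S' : Set (Formula (henkinCtx (n + 1))) // MaximalConsistent Ax S'},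
        (∀ φ ∈ S.1, (φ.wk : Formula (henkinCtx (n + 1))) ∈ S'.1) ∧
        (Formula.all (henkinType n) (henkinFormula n) ∉ S.1 →
          (henkinFormula n : Formula (henkinCtx (n + 1))) ∉ S'.1) := by
    intro n S
    by_cases h : Formula.all (henkinType n) (henkinFormula n) ∈ S.1
    -- No counterexample is wanted here, but the level still adds a variable; `∀ x, ⊥` serves as a
    -- dummy unprovable formula.
    · obtain ⟨S', h₁, -, h₃⟩ := S.2.exists_counterexample (S.2.all_fal_notMem (σ := henkinType n))
      exact ⟨⟨S', h₁⟩, h₃, fun h' => absurd h h'⟩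
    · obtain ⟨S', h₁, h₂, h₃⟩ := S.2.exists_counterexample h
      exact ⟨⟨S', h₁⟩, h₃, fun _ => h₂⟩
  choose next hnext using step
  let 𝒮 : (n : ℕ) → {S : Set (Formula (henkinCtx n)) // MaximalConsistent Ax S} :=
    fun n => Nat.rec (motive := fun n => {S : Set (Formula (henkinCtx n)) //
      MaximalConsistent Ax S}) ⟨T', hT'⟩ next n
  exact ⟨⟨fun n => (𝒮 n).1, fun n => (𝒮 n).2, fun n => (hnext n (𝒮 n)).1,
    fun n => (hnext n (𝒮 n)).2⟩, hT₀⟩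

namespace HenkinTheory

variable (𝒯 : HenkinTheory Ax)

theorem up_mem {m n : ℕ} (h : m ≤ n) {φ : Formula (henkinCtx m)} (hφ : φ ∈ 𝒯.T m) :
    φ.subst (henkinUp h) ∈ 𝒯.T n := by
  induction n, h using Nat.le_induction with
  | base => rwa [henkinUp_refl, Formula.subst_id]
  | succ n h ih =>
    have := 𝒯.wk_mem n _ ih
    rw [Formula.wk, Formula.subst_subst] at this
    rw [henkinUp_succ h]
    exact this

/-- Later levels are conservative over earlier ones: a formula missing at level `m` has its negation
there, and the negation persists. -/
theorem up_mem_iff {m n : ℕ} (h : m ≤ n) {φ : Formula (henkinCtx m)} :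
    φ.subst (henkinUp h) ∈ 𝒯.T n ↔ φ ∈ 𝒯.T m := by
  refine ⟨fun hn => ?_, 𝒯.up_mem h⟩
  by_contra hm
  exact (𝒯.maximal n).neg_mem_iff.1 (𝒯.up_mem h ((𝒯.maximal m).neg_mem_iff.2 hm)) hn

/-- The term model of a Henkin theory. -/
noncomputable def model : PreModel where
  C τ := Σ n, Term (henkinCtx n) τ
  app f t := ⟨max f.1 t.1, Term.app (f.2.subst (henkinUp (le_max_left _ _)))
    (t.2.subst (henkinUp (le_max_right _ _)))⟩
  con c := ⟨0, Term.con c⟩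
  st t := Formula.st t.2 ∈ 𝒯.T t.1
  eq0 s t := Formula.eq0 (s.2.subst (henkinUp (le_max_left _ _)))
    (t.2.subst (henkinUp (le_max_right _ _))) ∈ 𝒯.T (max s.1 t.1)

/-- An object of the term model is represented by a term of a certain level. -/
def Rep {τ : Ty} (n : ℕ) (a : 𝒯.model.C τ) (t : Term (henkinCtx n) τ) : Prop :=
  ∃ h : a.1 ≤ n, a.2.subst (henkinUp h) = t

variable {𝒯}

theorem Rep.up {τ : Ty} {m n : ℕ} {a : 𝒯.model.C τ} {t : Term (henkinCtx m) τ}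
    (h : 𝒯.Rep m a t) (hmn : m ≤ n) : 𝒯.Rep n a (t.subst (henkinUp hmn)) := by
  obtain ⟨h, rfl⟩ := h
  exact ⟨h.trans hmn, (Term.subst_henkinUp_henkinUp _ _ _).symm⟩

theorem rep_eval {Γ : Ctx} {n : ℕ} {e : 𝒯.model.Env Γ} {s : Subst Γ (henkinCtx n)}
    (hs : ∀ τ x, 𝒯.Rep n (e τ x) (s τ x)) {τ : Ty} (t : Term Γ τ) :
    𝒯.Rep n (PreModel.eval e t) (t.subst s) := by
  induction t with
  | var x => exact hs _ x
  | con c => exact ⟨Nat.zero_le n, rfl⟩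
  | app f t hf ht =>
    obtain ⟨hf, hf'⟩ := hf
    obtain ⟨ht, ht'⟩ := ht
    refine ⟨max_le hf ht, ?_⟩
    exact congrArg₂ Term.app ((Term.subst_henkinUp_henkinUp _ _ _).trans hf')
      ((Term.subst_henkinUp_henkinUp _ _ _).trans ht')

/-- The truth lemma, with all free variables represented at a common level `n`. For a universal
formula, one direction uses the Henkin variables and the other instantiation at a possibly higher
level. -/
theorem sat_iff_mem {Γ : Ctx} {n : ℕ} {e : 𝒯.model.Env Γ} {s : Subst Γ (henkinCtx n)}
    (hs : ∀ τ x, 𝒯.Rep n (e τ x) (s τ x)) (φ : Formula Γ) :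
    PreModel.Sat e φ ↔ φ.subst s ∈ 𝒯.T n := by
  induction φ generalizing n with
  | eq0 t u =>
    obtain ⟨ht, ht'⟩ := rep_eval hs t
    obtain ⟨hu, hu'⟩ := rep_eval hs u
    rw [Formula.subst, ← ht', ← hu']
    refine (𝒯.up_mem_iff (max_le ht hu)).symm.trans ?_
    rw [Formula.subst, Term.subst_subst, Term.subst_subst, henkinUp_trans, henkinUp_trans]
  | st t =>
    obtain ⟨ht, ht'⟩ := rep_eval hs t
    rw [Formula.subst, ← ht']
    exact (𝒯.up_mem_iff ht).symm
  | fal => exact iff_of_false not_false (𝒯.maximal n).fal_notMem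
  | imp φ ψ hφ hψ => rw [Formula.subst, (𝒯.maximal n).imp_mem_iff, ← hφ hs, ← hψ hs]; rfl
  | all σ φ ih =>
    constructor
    · intro h
      by_contra hn
      rw [Formula.subst] at hn
      -- The variable added at level `m + 1` is the counterexample; `h` is applied to it.
      obtain ⟨m, hnm, hσ, hm⟩ := exists_henkinFormula_eq (φ.subst s.lift)
      subst hσ
      rw [← 𝒯.up_mem_iff hnm] at hn
      refine (hm ▸ 𝒯.counterexample m) hn ?_
      have hr : ∀ τ x, 𝒯.Rep (m + 1)
          (PreModel.Env.cons (⟨m + 1, Term.var Var.zero⟩ : 𝒯.model.C _) e τ x)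
          ((Subst.lift (s.comp (henkinUp hnm)) : Subst _ (henkinCtx (m + 1))) τ x) := by
        intro τ x
        cases x with
        | zero => exact ⟨le_rfl, Term.subst_henkinUp_refl _⟩
        | succ x =>
          have := ((hs _ x).up hnm).up (Nat.le_succ m)
          rw [henkinUp_succ le_rfl, henkinUp_refl] at this
          exact this
      have := (ih hr).1 (h _)
      rw [← Subst.lift_comp] at this
      exact (Formula.subst_subst _ _ _).symm ▸ this
    · intro h a
      have hr : ∀ τ x, 𝒯.Rep (max n a.1) (PreModel.Env.cons a e τ x)
          (Subst.cons (a.2.subst (henkinUp (le_max_right n a.1)))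
            (s.comp (henkinUp (le_max_left n a.1))) τ x) := by
        intro τ x
        cases x with
        | zero => exact ⟨le_max_right _ _, rfl⟩
        | succ x => exact (hs _ x).up _
      rw [ih hr]
      have h' := (𝒯.maximal _).inst_mem (𝒯.up_mem (le_max_left n a.1) h)
        (a.2.subst (henkinUp (le_max_right n a.1)))
      rw [Formula.inst, Formula.subst_subst, Formula.subst_subst, Subst.lift_comp_cons,
        Subst.lift_comp_cons, Subst.comp_id] at h'
      exact h'

end HenkinTheory

/-! ### The completeness theorem -/

theorem PreModel.sat_of_sat_closure {M : PreModel} {Γ : Ctx} {φ : Formula Γ}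
    (h : M.Sat PreModel.Env.nil (Formula.closure Γ φ)) (e : M.Env Γ) : M.Sat e φ := by
  induction Γ with
  | nil =>
    have : e = PreModel.Env.nil := by funext τ x; cases x
    rwa [this]
  | cons σ Γ ih =>
    have : e = PreModel.Env.cons (e _ Var.zero) (fun τ x => e τ x.succ) := by
      funext τ x; cases x <;> rfl
    rw [this]
    exact ih h (fun τ x => e τ x.succ) _

/-- Completeness: what holds in all structures satisfying the axioms and the hypotheses is
derivable. -/
theorem derives_of_forall_sat {H : List (Formula [])} {φ : Formula []}
    (h : ∀ M : PreModel, (∀ (Γ : Ctx) (ψ : Formula Γ), Ax Γ ψ → ∀ e : M.Env Γ, M.Sat e ψ) →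
      (∀ ψ ∈ H, M.Sat PreModel.Env.nil ψ) → M.Sat PreModel.Env.nil φ) :
    Derives Ax [] H φ := by
  by_contra hn
  have hc : Consistent Ax (insert φ.neg {ψ | ψ ∈ H}) := by
    intro L hL hd
    obtain ⟨L', hL', hsub⟩ := exists_list_of_insert L hL
    exact hn (Derives.mono (.raa (hd.mono hsub)) hL')
  obtain ⟨𝒯, h𝒯⟩ := HenkinTheory.exists_of_consistent hc
  have key : ∀ ψ : Formula [], 𝒯.model.Sat PreModel.Env.nil ψ ↔ ψ ∈ 𝒯.T 0 := fun ψ => by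
    refine (HenkinTheory.sat_iff_mem (n := 0) (s := Subst.id) (fun _ x => nomatch x) ψ).trans ?_
    exact iff_of_eq (congrArg (· ∈ 𝒯.T 0) (Formula.subst_id ψ))
  refine (𝒯.maximal 0).neg_mem_iff.1 (h𝒯 (Set.mem_insert _ _)) ((key _).1 (h 𝒯.model ?_ ?_))
  -- Axioms have free variables whereas `key` concerns closed formulas, hence the detour through the
  -- universal closure.
  · intro Γ ψ hψ e
    refine PreModel.sat_of_sat_closure ((key _).2 ?_) e
    exact (𝒯.maximal 0).mem_of_derives (L := []) (by simp) (Derives.ax hψ).closure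
  · exact fun ψ hψ => (key _).2 (h𝒯 (Set.mem_insert_of_mem _ hψ))

end NSA

namespace NSA

namespace PreModel

variable {M : PreModel} {Γ Δ : Ctx}

/-! ## Satisfaction of the defined connectives -/

section Connectives

variable (e : M.Env Γ) (φ ψ : Formula Γ)

theorem sat_imp : M.Sat e (φ ⇒ₚ ψ) ↔ (M.Sat e φ → M.Sat e ψ) := Iff.rfl

theorem sat_all {σ : Ty} (χ : Formula (σ :: Γ)) :
    M.Sat e (Formula.all σ χ) ↔ ∀ a, M.Sat (Env.cons a e) χ := Iff.rfl

theorem sat_neg : M.Sat e φ.neg ↔ ¬ M.Sat e φ := Iff.rfl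

theorem sat_or : M.Sat e (φ.or ψ) ↔ M.Sat e φ ∨ M.Sat e ψ := by
  rw [Formula.or, sat_imp, sat_neg]
  tauto

theorem sat_and : M.Sat e (φ.and ψ) ↔ M.Sat e φ ∧ M.Sat e ψ := by
  rw [Formula.and, sat_neg, sat_imp, sat_neg]
  tauto

theorem sat_ex {σ : Ty} (χ : Formula (σ :: Γ)) :
    M.Sat e (Formula.ex σ χ) ↔ ∃ a, M.Sat (Env.cons a e) χ := by
  rw [Formula.ex, sat_neg, sat_all]
  simp only [sat_neg, not_forall, not_not]

theorem sat_allSt {σ : Ty} (χ : Formula (σ :: Γ)) :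
    M.Sat e (Formula.allSt σ χ) ↔ ∀ a, M.st a → M.Sat (Env.cons a e) χ := Iff.rfl

theorem sat_exSt {σ : Ty} (χ : Formula (σ :: Γ)) :
    M.Sat e (Formula.exSt σ χ) ↔ ∃ a, M.st a ∧ M.Sat (Env.cons a e) χ := by
  rw [Formula.exSt, sat_ex]
  simp only [sat_and]
  rfl

end Connectives

/-! ## Substitution -/

theorem eval_subst (e : M.Env Δ) (s : Subst Γ Δ) {τ : Ty} (t : Term Γ τ) :
    M.eval e (t.subst s) = M.eval (fun τ x => M.eval e (s τ x)) t := by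
  induction t with
  | var x => rfl
  | con c => rfl
  | app f t hf ht => simp only [Term.subst, eval, hf, ht]

@[simp] theorem eval_v0 {σ : Ty} (a : M.C σ) (e : M.Env Γ) : M.eval (Env.cons a e) v0 = a := rfl

@[simp] theorem eval_var_succ {σ τ : Ty} (a : M.C σ) (e : M.Env Γ) (x : Var Γ τ) :
    M.eval (Env.cons a e) (Term.var x.succ) = M.eval e (Term.var x) := rfl

@[simp] theorem eval_app (e : M.Env Γ) {σ τ : Ty} (f : Term Γ (σ ⇒ₜ τ)) (t : Term Γ σ) :
    M.eval e (Term.app f t) = M.app (M.eval e f) (M.eval e t) := rfl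

@[simp] theorem eval_con (e : M.Env Γ) {τ : Ty} (c : Const τ) :
    M.eval e (Term.con c) = M.con c := rfl

@[simp] theorem eval_wk {σ : Ty} (a : M.C σ) (e : M.Env Γ) {τ : Ty} (t : Term Γ τ) :
    M.eval (Env.cons a e) t.wk = M.eval e t :=
  eval_subst _ _ _

theorem eval_lift {σ : Ty} (a : M.C σ) (e : M.Env Δ) (s : Subst Γ Δ) :
    (fun τ x => M.eval (Env.cons a e) (s.lift (σ := σ) τ x)) =
      Env.cons a (fun τ x => M.eval e (s τ x)) := by
  funext τ x
  cases x with
  | zero => rfl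
  | succ x => exact eval_wk _ _ _

theorem sat_subst (e : M.Env Δ) (s : Subst Γ Δ) (φ : Formula Γ) :
    M.Sat e (φ.subst s) ↔ M.Sat (fun τ x => M.eval e (s τ x)) φ := by
  induction φ generalizing Δ with
  | eq0 t u => simp only [Formula.subst, Sat, eval_subst]
  | st t => simp only [Formula.subst, Sat, eval_subst]
  | fal => rfl
  | imp φ ψ hφ hψ => simp only [Formula.subst, Sat, hφ, hψ]
  | all σ φ ih => simp only [Formula.subst, Sat, ih, eval_lift]

theorem eval_subst_cons {σ : Ty} (e : M.Env Δ) (t : Term Δ σ) (s : Subst Γ Δ) :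
    (fun τ x => M.eval e (Subst.cons t s τ x)) =
      Env.cons (M.eval e t) (fun τ x => M.eval e (s τ x)) := by
  funext τ x
  cases x <;> rfl

theorem sat_inst {σ : Ty} (e : M.Env Γ) (t : Term Γ σ) (φ : Formula (σ :: Γ)) :
    M.Sat e (φ.inst t) ↔ M.Sat (Env.cons (M.eval e t) e) φ := by
  rw [Formula.inst, sat_subst, eval_subst_cons]
  rfl

/-! ## Equality at all types -/

variable (M) in
/-- The step function in the definition of truncated subtraction. -/
def monusStep : M.C (Ty.nat ⇒ₜ Ty.nat ⇒ₜ Ty.nat) :=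
  M.eval Env.nil (Term.abs (Term.abs (predT v1)))

/-- Truncated subtraction in a structure. -/
def monus (a b : M.C Ty.nat) : M.C Ty.nat :=
  M.app (M.app (M.app (M.con Const.recN) b) a) M.monusStep

variable (M) in
/-- The number `0`. -/
def zero : M.C Ty.nat := M.con Const.zero

/-- The successor. -/
def succ (a : M.C Ty.nat) : M.C Ty.nat := M.app (M.con Const.succ) a

/-- The length of a finite sequence. -/
def len {σ : Ty} (w : M.C (Ty.seq σ)) : M.C Ty.nat := M.app (M.con (Const.len σ)) w

/-- An entry of a finite sequence. -/
def entry {σ : Ty} (w : M.C (Ty.seq σ)) (i : M.C Ty.nat) : M.C σ :=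
  M.app (M.app (M.con (Const.entry σ)) w) i

theorem eval_monusT (e : M.Env Γ) (s t : Term Γ Ty.nat) :
    M.eval e (monusT s t) = monus (M.eval e s) (M.eval e t) := rfl

theorem sat_lt (e : M.Env Γ) (s t : Term Γ Ty.nat) :
    M.Sat e (Formula.lt s t) ↔ M.eq0 (monus (succ (M.eval e s)) (M.eval e t)) M.zero := Iff.rfl

/-- The interpretation of the defined equality. -/
def Eqv : (τ : Ty) → M.C τ → M.C τ → Prop
  | Ty.nat, a, b => M.eq0 a b
  | Ty.arrow σ τ, f, g => ∀ a : M.C σ, Eqv τ (M.app f a) (M.app g a)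
  | Ty.seq σ, v, w => M.eq0 (len v) (len w) ∧
      ∀ i, M.eq0 (monus (succ i) (len v)) M.zero → Eqv σ (entry v i) (entry w i)

theorem sat_eq {τ : Ty} (e : M.Env Γ) (s t : Term Γ τ) :
    M.Sat e (Formula.eq τ s t) ↔ Eqv τ (M.eval e s) (M.eval e t) := by
  induction τ generalizing Γ with
  | nat => rfl
  | arrow σ τ _ ih => simp only [Formula.eq, sat_all, ih, eval, eval_wk, Env.cons, Eqv]
  | seq σ ih =>
    simp only [Formula.eq, sat_and, sat_all, sat_imp, ih, sat_lt, eval, eval_wk, Env.cons, Eqv]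
    rfl

/-! ## The quotient by equality -/

section Quotient

variable (hM : ∀ (Γ : Ctx) (ψ : Formula Γ), P0Axiom Γ ψ → ∀ e : M.Env Γ, M.Sat e ψ)
include hM

theorem eq0_refl (a : M.C Ty.nat) : M.eq0 a a :=
  hM _ _ (.epra _ (.refl (v0 : Term [Ty.nat] _))) (Env.cons a Env.nil)

theorem eq0_symm {a b : M.C Ty.nat} (h : M.eq0 a b) : M.eq0 b a :=
  hM _ _ (.epra _ (.symm (v0 : Term [Ty.nat, Ty.nat] _) v1)) (Env.cons a (Env.cons b Env.nil)) h

theorem eq0_trans {a b c : M.C Ty.nat} (h : M.eq0 a b) (h' : M.eq0 b c) : M.eq0 a c :=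
  hM _ _ (.epra _ (.trans (v0 : Term [Ty.nat, Ty.nat, Ty.nat] _) v1 v2))
    (Env.cons a (Env.cons b (Env.cons c Env.nil))) h h'

theorem Eqv.app_right {σ τ : Ty} (f : M.C (σ ⇒ₜ τ)) {a b : M.C σ} (h : Eqv σ a b) :
    Eqv τ (M.app f a) (M.app f b) := by
  have := hM _ _ (.epra _ (.ext σ τ (v2 : Term [σ, σ, σ ⇒ₜ τ] _) v0 v1))
    (Env.cons a (Env.cons b (Env.cons f Env.nil)))
  rw [sat_imp, sat_eq, sat_eq] at this
  exact this h

theorem Eqv.refl {τ : Ty} (a : M.C τ) : Eqv τ a a := by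
  induction τ with
  | nat => exact eq0_refl hM a
  | arrow σ τ _ ih => exact fun _ => ih _
  | seq σ ih => exact ⟨eq0_refl hM _, fun _ _ => ih _⟩

/-- Equality of sequences bounds the indices by the length of the left sequence only, so symmetry
and transitivity must move this bound to an equal length. -/
theorem eq0_monus (a : M.C Ty.nat) {b c d : M.C Ty.nat} (h : M.eq0 b c)
    (hb : M.eq0 (monus a b) d) : M.eq0 (monus a c) d :=
  eq0_trans hM (eq0_symm hM (Eqv.app_right hM (M.con Const.recN) h a M.monusStep)) hb

theorem Eqv.symm {τ : Ty} {a b : M.C τ} (h : Eqv τ a b) : Eqv τ b a := by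
  induction τ with
  | nat => exact eq0_symm hM h
  | arrow σ τ _ ih => exact fun _ => ih (h _)
  | seq σ ih =>
    exact ⟨eq0_symm hM h.1, fun i hi => ih (h.2 i (eq0_monus hM _ (eq0_symm hM h.1) hi))⟩

theorem Eqv.trans {τ : Ty} {a b c : M.C τ} (h : Eqv τ a b) (h' : Eqv τ b c) : Eqv τ a c := by
  induction τ with
  | nat => exact eq0_trans hM h h'
  | arrow σ τ _ ih => exact fun _ => ih (h _) (h' _)
  | seq σ ih =>
    exact ⟨eq0_trans hM h.1 h'.1, fun i hi => ih (h.2 i hi) (h'.2 i (eq0_monus hM _ h.1 hi))⟩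

/-- In the function place equality is pointwise by definition; in the argument place congruence is
the extensionality axiom. -/
theorem Eqv.app {σ τ : Ty} {f g : M.C (σ ⇒ₜ τ)} {a b : M.C σ} (hf : Eqv (σ ⇒ₜ τ) f g)
    (h : Eqv σ a b) : Eqv τ (M.app f a) (M.app g b) :=
  (hf a).trans hM (h.app_right hM g)

theorem Eqv.st {τ : Ty} {a b : M.C τ} (h : Eqv τ a b) (ha : M.st a) : M.st b := by
  have := hM _ _ (.st_eq τ (v0 : Term [τ, τ] _) v1) (Env.cons a (Env.cons b Env.nil))
  rw [sat_imp, sat_imp, sat_eq] at this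
  exact this ha h

/-- Equality as an equivalence relation. -/
def setoid (τ : Ty) : Setoid (M.C τ) where
  r := Eqv τ
  iseqv := ⟨Eqv.refl hM, Eqv.symm hM, Eqv.trans hM⟩

/-- The quotient by equality. -/
def quotient : PreModel where
  C τ := Quotient (setoid hM τ)
  app := @fun σ τ => Quotient.map₂ M.app fun _ _ hf _ _ h => Eqv.app (σ := σ) (τ := τ) hM hf h
  con c := Quotient.mk _ (M.con c)
  st := @fun τ => Quotient.lift M.st fun _ _ h =>
    propext ⟨Eqv.st (τ := τ) hM h, Eqv.st (τ := τ) hM (h.symm hM)⟩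
  eq0 a b := a = b

/-- The class of an assignment. -/
def Env.mk (e : M.Env Γ) : (quotient hM).Env Γ := fun τ x => Quotient.mk (setoid hM τ) (e τ x)

theorem Env.mk_cons {σ : Ty} (a : M.C σ) (e : M.Env Γ) :
    (Env.cons a e).mk hM = Env.cons (M := quotient hM) (Quotient.mk (setoid hM σ) a) (e.mk hM) := by
  funext τ x
  cases x <;> rfl

theorem Env.exists_mk (e : (quotient hM).Env Γ) : ∃ e' : M.Env Γ, e'.mk hM = e :=
  ⟨fun τ x => Quotient.out (s := setoid hM τ) (e τ x),
    funext fun τ => funext fun x => Quotient.out_eq (s := setoid hM τ) (e τ x)⟩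

theorem eval_quotient (e : M.Env Γ) {τ : Ty} (t : Term Γ τ) :
    (quotient hM).eval (e.mk hM) t = Quotient.mk (setoid hM τ) (M.eval e t) := by
  induction t with
  | var x => rfl
  | con c => rfl
  | app f t hf ht =>
    rw [eval, hf, ht]
    rfl

theorem sat_quotient (e : M.Env Γ) (φ : Formula Γ) :
    (quotient hM).Sat (e.mk hM) φ ↔ M.Sat e φ := by
  induction φ with
  | eq0 s t =>
    rw [Sat, eval_quotient, eval_quotient]
    exact ⟨fun h => Quotient.exact (s := setoid hM Ty.nat) h,
      fun h => Quotient.sound (s := setoid hM Ty.nat) h⟩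
  | st t =>
    rw [Sat, eval_quotient]
    rfl
  | fal => rfl
  | imp φ ψ hφ hψ => rw [sat_imp, sat_imp, hφ, hψ]
  | all σ φ ih =>
    rw [sat_all, sat_all]
    refine ⟨fun h a => ?_, fun h a => ?_⟩
    · rw [← ih, Env.mk_cons]
      exact h _
    · obtain ⟨a, rfl⟩ := Quotient.exists_rep (s := setoid hM σ) a
      have := h a
      rwa [← ih, Env.mk_cons] at this

/-- The quotient preserves satisfaction of the formula `Formula.eq`, so defined equality becomes
identity at every type, not only at type 0. -/
theorem eqv_quotient_iff {τ : Ty} (a b : (quotient hM).C τ) : Eqv τ a b ↔ a = b := by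
  obtain ⟨a, rfl⟩ := Quotient.exists_rep (s := setoid hM τ) a
  obtain ⟨b, rfl⟩ := Quotient.exists_rep (s := setoid hM τ) b
  have h := sat_quotient hM (Env.cons a (Env.cons b Env.nil)) (Formula.eq τ v0 v1)
  rw [sat_eq, sat_eq, eval_quotient, eval_quotient] at h
  exact h.trans ⟨fun h => Quotient.sound (s := setoid hM τ) h,
    fun h => Quotient.exact (s := setoid hM τ) h⟩

end Quotient

end PreModel

/-! ### Completeness for extensional models -/

/-- Extensional models of `P₀` with true equality. -/
structure IsModel (M : PreModel) : Prop where
  sat : ∀ {Γ : Ctx} {ψ : Formula Γ}, P0Axiom Γ ψ → ∀ e : M.Env Γ, M.Sat e ψ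
  eq0_iff : ∀ a b, M.eq0 a b ↔ a = b
  eqv_iff : ∀ {τ : Ty} (a b : M.C τ), PreModel.Eqv τ a b ↔ a = b

/-- Completeness of derivability in `P₀` for its extensional models. -/
theorem derives_of_forall_isModel {H : List (Formula [])} {φ : Formula []}
    (h : ∀ M : PreModel, IsModel M → (∀ ψ ∈ H, M.Sat PreModel.Env.nil ψ) →
      M.Sat PreModel.Env.nil φ) : Derives P0Axiom [] H φ := by
  refine derives_of_forall_sat fun M hM hH => ?_
  have hnil : PreModel.Env.mk hM (PreModel.Env.nil (M := M)) = PreModel.Env.nil := by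
    funext τ x
    cases x
  have key : ∀ ψ : Formula [], (PreModel.quotient hM).Sat PreModel.Env.nil ψ ↔
      M.Sat PreModel.Env.nil ψ := fun ψ => by
    rw [← hnil, PreModel.sat_quotient]
  refine (key φ).1 (h _ ⟨fun hψ e => ?_, fun a b => Iff.rfl, PreModel.eqv_quotient_iff hM⟩
    fun ψ hψ => (key ψ).2 (hH ψ hψ))
  obtain ⟨e, rfl⟩ := PreModel.Env.exists_mk hM e
  exact (PreModel.sat_quotient hM _ _).2 (hM _ _ hψ e)

end NSA

namespace NSA

/-! ### Terms for addition, case distinction and bounded search -/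

section ArithmeticTerms

variable {Γ : Ctx}

/-- Addition of numbers. -/
def addT (s t : Term Γ Ty.nat) : Term Γ Ty.nat := recT t s (Term.abs (Term.abs (succT v1)))

/-- Definition by cases: `a` if `t = 0`, and `b` otherwise. -/
def condT (t a b : Term Γ Ty.nat) : Term Γ Ty.nat := recT t a (Term.abs (Term.abs b.wk.wk))

/-- A number that vanishes if and only if two numbers are equal. -/
def eqT (s t : Term Γ Ty.nat) : Term Γ Ty.nat := addT (monusT s t) (monusT t s)

/-- The greatest zero below `n` of a function, if there is one. -/
def searchT (n : Term Γ Ty.nat) (b : Term Γ Ty.one) : Term Γ Ty.nat :=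
  recT n zeroT (Term.abs (Term.abs (condT (Term.app b.wk.wk v0) v0 v1)))

/-- A number that vanishes if and only if a function has a zero below `n`. -/
def boundedExT (n : Term Γ Ty.nat) (b : Term Γ Ty.one) : Term Γ Ty.nat :=
  addT (monusT (succT (searchT n b)) n) (Term.app b (searchT n b))

end ArithmeticTerms

namespace PreModel

variable {M : PreModel} {Γ : Ctx}

/-- Addition in a structure. -/
def add (a b : M.C Ty.nat) : M.C Ty.nat :=
  M.eval (Env.cons a (Env.cons b Env.nil)) (addT v0 v1)

/-- The predecessor in a structure. -/
def pred (a : M.C Ty.nat) : M.C Ty.nat := M.eval (Env.cons a Env.nil) (predT v0)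

theorem eval_predT (e : M.Env Γ) (t : Term Γ Ty.nat) :
    M.eval e (predT t) = pred (M.eval e t) := rfl

open Classical in
/-- Definition by cases in a structure. -/
noncomputable def ifZero (c a b : M.C Ty.nat) : M.C Ty.nat := if c = M.zero then a else b

variable (M) in
/-- The step function of the search for a zero of `b`. -/
def searchStep (b : M.C Ty.one) : M.C (Ty.nat ⇒ₜ Ty.nat ⇒ₜ Ty.nat) :=
  M.eval (Env.cons b Env.nil) (Term.abs (Term.abs (condT (Term.app v2 v0) v0 v1)))

variable (M) in
/-- The greatest zero of `b` below `n`, if there is one. -/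
def search (b : M.C Ty.one) (n : M.C Ty.nat) : M.C Ty.nat :=
  M.app (M.app (M.app (M.con Const.recN) n) M.zero) (searchStep M b)

theorem st_nil (τ : Ty) (x : Var [] τ) : M.st (Env.nil τ x) := nomatch x

theorem st_cons {σ : Ty} {a : M.C σ} {e : M.Env Γ} (ha : M.st a) (he : ∀ τ x, M.st (e τ x))
    (τ : Ty) (x : Var (σ :: Γ) τ) : M.st (Env.cons a e τ x) := by
  cases x with
  | zero => exact ha
  | succ x => exact he _ x

end PreModel

namespace IsModel

open PreModel

variable {M : PreModel} (hM : IsModel M) {Γ : Ctx}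
include hM

/-! ## The axioms in models -/

theorem sat_eq0 (e : M.Env Γ) (s t : Term Γ Ty.nat) :
    M.Sat e (Formula.eq0 s t) ↔ M.eval e s = M.eval e t :=
  hM.eq0_iff _ _

theorem sat_eq {τ : Ty} (e : M.Env Γ) (s t : Term Γ τ) :
    M.Sat e (Formula.eq τ s t) ↔ M.eval e s = M.eval e t := by
  rw [PreModel.sat_eq, hM.eqv_iff]

theorem sat_le (e : M.Env Γ) (s t : Term Γ Ty.nat) :
    M.Sat e (Formula.le s t) ↔ monus (M.eval e s) (M.eval e t) = M.zero :=
  hM.eq0_iff _ _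

theorem sat_lt (e : M.Env Γ) (s t : Term Γ Ty.nat) :
    M.Sat e (Formula.lt s t) ↔ monus (succ (M.eval e s)) (M.eval e t) = M.zero :=
  hM.eq0_iff _ _

theorem sat_mem {σ : Ty} (e : M.Env Γ) (q : Term Γ σ) (w : Term Γ (Ty.seq σ)) :
    M.Sat e (Formula.mem q w) ↔
      ∃ i, monus (succ i) (len (M.eval e w)) = M.zero ∧ entry (M.eval e w) i = M.eval e q := by
  simp only [Formula.mem, sat_ex, sat_and, hM.sat_lt, hM.sat_eq, eval, eval_wk, Env.cons]
  rfl

theorem funext {σ τ : Ty} {f g : M.C (σ ⇒ₜ τ)} (h : ∀ a, M.app f a = M.app g a) : f = g :=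
  (hM.eqv_iff f g).1 fun a => (hM.eqv_iff _ _).2 (h a)

theorem app_k {σ τ : Ty} (a : M.C σ) (b : M.C τ) :
    M.app (M.app (M.con (Const.k σ τ)) a) b = a :=
  (hM.sat_eq _ _ _).1 (hM.sat (.epra _ (.k σ τ (v0 : Term [σ, τ] _) v1))
    (Env.cons a (Env.cons b Env.nil)))

theorem app_s {ρ σ τ : Ty} (a : M.C (ρ ⇒ₜ σ ⇒ₜ τ)) (b : M.C (ρ ⇒ₜ σ)) (c : M.C ρ) :
    M.app (M.app (M.app (M.con (Const.s ρ σ τ)) a) b) c = M.app (M.app a c) (M.app b c) :=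
  (hM.sat_eq _ _ _).1 (hM.sat
    (.epra _ (.s ρ σ τ (v0 : Term [ρ ⇒ₜ σ ⇒ₜ τ, ρ ⇒ₜ σ, ρ] _) v1 v2))
    (Env.cons a (Env.cons b (Env.cons c Env.nil))))

/-- The `β`-rule. -/
theorem app_eval_abs {σ τ : Ty} (e : M.Env Γ) (t : Term (σ :: Γ) τ) (a : M.C σ) :
    M.app (M.eval e t.abs) a = M.eval (Env.cons a e) t := by
  induction t with
  | var x =>
    cases x with
    | zero => simp only [Term.abs, eval, hM.app_s, hM.app_k, Env.cons]
    | succ x => simp only [Term.abs, eval, hM.app_k, Env.cons]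
  | con c => simp only [Term.abs, eval, hM.app_k]
  | app f t hf ht =>
    simp only [Term.abs, eval, hM.app_s] at hf ht ⊢
    rw [hf, ht]

theorem succ_ne_zero (a : M.C Ty.nat) : succ a ≠ M.zero := fun h =>
  hM.sat (.epra _ (.succ_ne_zero (v0 : Term [Ty.nat] _))) (Env.cons a Env.nil)
    ((hM.eq0_iff _ _).2 h)

theorem succ_inj {a b : M.C Ty.nat} (h : succ a = succ b) : a = b :=
  (hM.eq0_iff _ _).1 (hM.sat (.epra _ (.succ_inj (v0 : Term [Ty.nat, Ty.nat] _) v1))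
    (Env.cons a (Env.cons b Env.nil)) ((hM.eq0_iff _ _).2 h))

theorem eval_recT_zero (e : M.Env Γ) (t y : Term Γ Ty.nat)
    (z : Term Γ (Ty.nat ⇒ₜ Ty.nat ⇒ₜ Ty.nat)) (h : M.eval e t = M.zero) :
    M.eval e (recT t y z) = M.eval e y := by
  have := (hM.sat_eq0 _ _ _).1 (hM.sat (.epra _ (.rec_zero y z)) e)
  simp only [eval] at this h ⊢
  rw [h]
  exact this

theorem eval_recT_succ (e : M.Env Γ) (t y : Term Γ Ty.nat)
    (z : Term (Ty.nat :: Ty.nat :: Γ) Ty.nat) (a : M.C Ty.nat) (h : M.eval e t = succ a) :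
    M.eval e (recT t y z.abs.abs) = M.eval (Env.cons a (Env.cons (M.app (M.app (M.app
      (M.con Const.recN) a) (M.eval e y)) (M.eval e z.abs.abs)) e)) z := by
  have := (hM.sat_eq0 _ _ _).1 (hM.sat (.epra _ (.rec_succ (v0 : Term (Ty.nat :: Γ) Ty.nat)
    y.wk z.abs.abs.wk)) (Env.cons a e))
  simp only [eval, eval_wk, hM.app_eval_abs] at this h ⊢
  rw [h]
  exact this

theorem induction (e : M.Env Γ) (φ : Formula (Ty.nat :: Γ)) (hφ : φ.QuantifierFree)
    (h₀ : M.Sat (Env.cons M.zero e) φ)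
    (h₁ : ∀ n, M.Sat (Env.cons n e) φ → M.Sat (Env.cons (succ n) e) φ) (n : M.C Ty.nat) :
    M.Sat (Env.cons n e) φ := by
  refine hM.sat (.epra _ (.induction φ hφ)) e ((sat_inst _ _ _).2 h₀) (fun a ha => ?_) n
  rw [sat_subst, eval_subst_cons]
  exact h₁ a ha

theorem st_con {τ : Ty} (c : Const τ) : M.st (M.con c) :=
  hM.sat (.st_closed τ (Term.con c)) Env.nil

theorem st_app {σ τ : Ty} {f : M.C (σ ⇒ₜ τ)} {a : M.C σ} (hf : M.st f) (ha : M.st a) :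
    M.st (M.app f a) :=
  hM.sat (.st_app σ τ (v0 : Term [σ ⇒ₜ τ, σ] _) v1) (Env.cons f (Env.cons a Env.nil)) hf ha

theorem st_eval {e : M.Env Γ} (he : ∀ τ x, M.st (e τ x)) {τ : Ty} (t : Term Γ τ) :
    M.st (M.eval e t) := by
  induction t with
  | var x => exact he _ x
  | con c => exact hM.st_con c
  | app f t hf ht => exact hM.st_app hf ht

theorem exists_st (τ : Ty) : ∃ a : M.C τ, M.st a :=
  ⟨M.eval Env.nil τ.defaultTerm, hM.st_eval st_nil _⟩

/-! ## Arithmetic in models -/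

theorem pred_zero : pred M.zero = M.zero := hM.eval_recT_zero _ _ _ _ rfl

theorem pred_succ (a : M.C Ty.nat) : pred (succ a) = a := hM.eval_recT_succ _ _ _ _ a rfl

theorem add_zero (a : M.C Ty.nat) : add a M.zero = a := hM.eval_recT_zero _ _ _ _ rfl

theorem add_succ (a b : M.C Ty.nat) : add a (succ b) = succ (add a b) :=
  hM.eval_recT_succ _ _ _ _ b rfl

theorem monus_zero (a : M.C Ty.nat) : monus a M.zero = a :=
  hM.eval_recT_zero (Env.cons a (Env.cons M.zero Env.nil)) v1 v0 (Term.abs (Term.abs (predT v1)))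
    rfl

theorem monus_succ (a b : M.C Ty.nat) : monus a (succ b) = pred (monus a b) :=
  hM.eval_recT_succ (Env.cons a (Env.cons (succ b) Env.nil)) v1 v0 (predT v1) b rfl

/-- Induction is restricted to quantifier-free formulas, so being a successor is expressed by `a =
S(pred a)`. -/
theorem eq_zero_or_succ (a : M.C Ty.nat) : a = M.zero ∨ ∃ b, a = succ b := by
  have := hM.induction (Γ := []) Env.nil (Formula.or (Formula.eq0 v0 zeroT)
    (Formula.eq0 v0 (succT (predT v0)))) ⟨⟨trivial, trivial⟩, trivial⟩
    ((sat_or _ _ _).2 (Or.inl ((hM.sat_eq0 _ _ _).2 rfl)))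
    (fun n _ => (sat_or _ _ _).2 (Or.inr ((hM.sat_eq0 _ _ _).2
      (congrArg succ (hM.pred_succ n)).symm))) a
  rw [sat_or, hM.sat_eq0, hM.sat_eq0] at this
  exact this.imp id fun h => ⟨_, h⟩

theorem zero_add (a : M.C Ty.nat) : add M.zero a = a :=
  (hM.sat_eq0 _ _ _).1 (hM.induction Env.nil (Formula.eq0 (addT zeroT v0) v0) trivial
    ((hM.sat_eq0 _ _ _).2 (hM.add_zero _))
    (fun n hn => (hM.sat_eq0 _ _ _).2 ((hM.add_succ _ n).trans
      (congrArg succ ((hM.sat_eq0 _ _ _).1 hn)))) a)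

theorem succ_add (a b : M.C Ty.nat) : add (succ a) b = succ (add a b) :=
  (hM.sat_eq0 _ _ _).1 (hM.induction (Env.cons a Env.nil)
    (Formula.eq0 (addT (succT v1) v0) (succT (addT v1 v0))) trivial
    ((hM.sat_eq0 _ _ _).2 ((hM.add_zero _).trans (congrArg succ (hM.add_zero a)).symm))
    (fun n hn => (hM.sat_eq0 _ _ _).2 ((hM.add_succ _ n).trans
      (congrArg succ (((hM.sat_eq0 _ _ _).1 hn).trans (hM.add_succ a n).symm)))) b)

theorem succ_monus_succ (a b : M.C Ty.nat) : monus (succ a) (succ b) = monus a b :=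
  (hM.sat_eq0 _ _ _).1 (hM.induction (Env.cons a Env.nil)
    (Formula.eq0 (monusT (succT v1) (succT v0)) (monusT v1 v0)) trivial
    ((hM.sat_eq0 _ _ _).2 (show monus (succ a) (succ M.zero) = monus a M.zero by
      rw [hM.monus_succ, hM.monus_zero, hM.monus_zero, hM.pred_succ]))
    (fun n hn => (hM.sat_eq0 _ _ _).2
      (show monus (succ a) (succ (succ n)) = monus a (succ n) by
        rw [hM.monus_succ, hM.monus_succ a]
        exact congrArg pred ((hM.sat_eq0 _ _ _).1 hn))) b)

theorem add_monus (a b : M.C Ty.nat) : monus (add a b) a = b :=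
  (hM.sat_eq0 _ _ _).1 (hM.induction (Env.cons b Env.nil)
    (Formula.eq0 (monusT (addT v0 v1) v0) v1) trivial
    ((hM.sat_eq0 _ _ _).2 (show monus (add M.zero b) M.zero = b by
      rw [hM.monus_zero, hM.zero_add]))
    (fun n hn => (hM.sat_eq0 _ _ _).2 (show monus (add (succ n) b) (succ n) = b by
      rw [hM.succ_add, hM.succ_monus_succ]
      exact (hM.sat_eq0 _ _ _).1 hn)) a)

theorem monus_self (a : M.C Ty.nat) : monus a a = M.zero := by
  have := hM.add_monus a M.zero
  rwa [hM.add_zero] at this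

theorem monus_eq_zero_or (a b : M.C Ty.nat) :
    monus a b = M.zero ∨ add (monus a b) b = a := by
  have := hM.induction (Env.cons a Env.nil) (Formula.or (Formula.eq0 (monusT v1 v0) zeroT)
    (Formula.eq0 (addT (monusT v1 v0) v0) v1)) ⟨⟨trivial, trivial⟩, trivial⟩
    ((sat_or _ _ _).2 (Or.inr ((hM.sat_eq0 _ _ _).2
      (show add (monus a M.zero) M.zero = a by rw [hM.monus_zero, hM.add_zero]))))
    (fun n hn => by
      rw [sat_or, hM.sat_eq0, hM.sat_eq0] at hn ⊢
      change monus a n = M.zero ∨ add (monus a n) n = a at hn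
      change monus a (succ n) = M.zero ∨ add (monus a (succ n)) (succ n) = a
      rw [hM.monus_succ]
      rcases hM.eq_zero_or_succ (monus a n) with h | ⟨c, h⟩
      · left; rw [h, hM.pred_zero]
      · right
        rw [h] at hn ⊢
        rw [hM.pred_succ, hM.add_succ, ← hM.succ_add]
        exact hn.resolve_left (hM.succ_ne_zero c)) b
  rw [sat_or, hM.sat_eq0, hM.sat_eq0] at this
  exact this

theorem eq_or_succ_monus {a b : M.C Ty.nat} (h : monus (succ a) (succ b) = M.zero) :
    a = b ∨ monus (succ a) b = M.zero := by
  rcases hM.eq_zero_or_succ (monus (succ a) b) with h' | ⟨c, h'⟩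
  · exact Or.inr h'
  · left
    rw [hM.monus_succ, h', hM.pred_succ] at h
    rw [h] at h'
    have := (hM.monus_eq_zero_or (succ a) b).resolve_left (h' ▸ hM.succ_ne_zero _)
    rw [h', hM.succ_add, hM.zero_add] at this
    exact (hM.succ_inj this).symm

theorem add_monus_cancel {a b : M.C Ty.nat} (h : monus a b = M.zero) :
    add a (monus b a) = b := by
  have := hM.induction (Env.cons a Env.nil) (Formula.imp (Formula.eq0 (monusT v1 v0) zeroT)
    (Formula.eq0 (addT v1 (monusT v0 v1)) v0)) ⟨trivial, trivial⟩
    (by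
      rw [sat_imp, hM.sat_eq0, hM.sat_eq0]
      change monus a M.zero = M.zero → add a (monus M.zero a) = M.zero
      rw [hM.monus_zero]
      rintro rfl
      rw [hM.monus_zero, hM.zero_add])
    (fun n hn => by
      rw [sat_imp, hM.sat_eq0, hM.sat_eq0] at hn ⊢
      change monus a n = M.zero → add a (monus n a) = n at hn
      change monus a (succ n) = M.zero → add a (monus (succ n) a) = succ n
      intro h
      rw [← hM.succ_monus_succ] at hn
      rcases hM.eq_zero_or_succ a with rfl | ⟨a, rfl⟩
      · rw [hM.monus_zero, hM.zero_add]
      · rcases hM.eq_or_succ_monus h with rfl | h'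
        · rw [hM.monus_self, hM.add_zero]
        · have h'' := hn (by rw [hM.succ_monus_succ]; exact h')
          -- By `h''`, `n + 1` is `(a + 1) + ((n - (a + 1)) + 1)`; subtracting the first summand
          -- leaves the second.
          have h3 : monus (succ n) (succ a) = succ (monus n (succ a)) := by
            conv_lhs => rw [← h'', ← hM.add_succ]
            exact hM.add_monus _ _
          rw [h3, hM.add_succ, h'']) b
  rw [sat_imp, hM.sat_eq0, hM.sat_eq0] at this
  exact this h

theorem add_eq_zero_iff (a b : M.C Ty.nat) :
    add a b = M.zero ↔ a = M.zero ∧ b = M.zero := by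
  rcases hM.eq_zero_or_succ b with rfl | ⟨b, rfl⟩
  · simp [hM.add_zero]
  · simp [hM.add_succ, hM.succ_ne_zero]

theorem eval_addT_eq_zero_iff (e : M.Env Γ) (s t : Term Γ Ty.nat) :
    M.eval e (addT s t) = M.zero ↔ M.eval e s = M.zero ∧ M.eval e t = M.zero :=
  hM.add_eq_zero_iff _ _

theorem eval_eqT_eq_zero_iff (e : M.Env Γ) (s t : Term Γ Ty.nat) :
    M.eval e (eqT s t) = M.zero ↔ M.eval e s = M.eval e t := by
  rw [eqT, hM.eval_addT_eq_zero_iff, eval_monusT, eval_monusT]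
  refine ⟨fun ⟨h₁, h₂⟩ => ?_, fun h => by rw [h, hM.monus_self]; simp⟩
  have := hM.add_monus_cancel h₁
  rwa [h₂, hM.add_zero] at this

theorem eval_condT (e : M.Env Γ) (t a b : Term Γ Ty.nat) :
    M.eval e (condT t a b) = ifZero (M.eval e t) (M.eval e a) (M.eval e b) := by
  rw [ifZero]
  split_ifs with h
  · exact hM.eval_recT_zero _ _ _ _ h
  · obtain ⟨c, hc⟩ := (hM.eq_zero_or_succ _).resolve_left h
    rw [condT, hM.eval_recT_succ _ _ _ _ c hc, eval_wk, eval_wk]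

/-- Abstraction produces different combinator terms for different `b`; extensionality shows that the
step function depends only on the value of `b`. -/
theorem eval_searchStep (e : M.Env Γ) (b : Term Γ Ty.one) :
    M.eval e (Term.abs (Term.abs (condT (Term.app b.wk.wk v0) v0 v1))) =
      searchStep M (M.eval e b) := by
  refine hM.funext fun w => hM.funext fun k => ?_
  simp only [searchStep, hM.app_eval_abs, hM.eval_condT]
  simp only [eval_app, eval_wk, eval_v0, eval_var_succ]

theorem eval_searchT (e : M.Env Γ) (n : Term Γ Ty.nat) (b : Term Γ Ty.one) :
    M.eval e (searchT n b) = search M (M.eval e b) (M.eval e n) := by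
  exact congrArg (M.app _) (hM.eval_searchStep e b)

theorem search_succ (b : M.C Ty.one) (k : M.C Ty.nat) :
    search M b (succ k) = ifZero (M.app b k) k (search M b k) := by
  have h := hM.eval_searchT (Env.cons (succ k) (Env.cons b Env.nil)) v0 v1
  rw [searchT, hM.eval_recT_succ _ _ _ _ k rfl, hM.eval_condT, hM.eval_searchStep] at h
  simp only [eval_app, eval_wk, eval_v0, eval_var_succ] at h
  exact h.symm

/-- The search returns the default `0` when nothing is found, so `boundedExT` rechecks that its
value is below `n` and is a zero. That a zero `i < n` makes the search succeed follows by induction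
on `n` with `i` fixed, which keeps the induction formula quantifier-free. -/
theorem eval_boundedExT_eq_zero_iff (e : M.Env Γ) (n : Term Γ Ty.nat) (b : Term Γ Ty.one) :
    M.eval e (boundedExT n b) = M.zero ↔
      ∃ i, monus (succ i) (M.eval e n) = M.zero ∧ M.app (M.eval e b) i = M.zero := by
  rw [boundedExT, hM.eval_addT_eq_zero_iff]
  refine ⟨fun h => ⟨_, h⟩, fun ⟨i, hi, hi'⟩ => ?_⟩
  change monus (succ (M.eval e (searchT n b))) _ = _ ∧ M.app _ (M.eval e (searchT n b)) = _
  rw [hM.eval_searchT]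
  generalize M.eval e b = β at *
  generalize M.eval e n = n at *
  have := hM.induction (Env.cons i (Env.cons β Env.nil)) (Formula.imp (Formula.lt v1 v0)
    (Formula.eq0 (addT (monusT (succT (searchT v0 v2)) v0)
      (Term.app v2 (searchT v0 v2))) zeroT)) ⟨trivial, trivial⟩ ?_ (fun k hk => ?_) n
  · rw [sat_imp, hM.sat_lt, hM.sat_eq0] at this
    have := (hM.eval_addT_eq_zero_iff _ _ _).1 (this hi)
    simp only [eval_monusT, eval_app, hM.eval_searchT, eval_v0, eval_var_succ] at this
    exact this
  · rw [sat_imp, hM.sat_lt]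
    intro h
    exact absurd ((hM.monus_zero _).symm.trans h) (hM.succ_ne_zero i)
  · rw [sat_imp, hM.sat_lt, hM.sat_eq0] at hk ⊢
    intro h
    refine (hM.eval_addT_eq_zero_iff _ _ _).2 ?_
    have hk := fun h => (hM.eval_addT_eq_zero_iff _ _ _).1 (hk h)
    simp only [eval_monusT, eval_app, hM.eval_searchT, eval_v0, eval_var_succ] at h hk ⊢
    change monus (succ (search M β (succ k))) (succ k) = M.zero ∧
      M.app β (search M β (succ k)) = M.zero
    rw [hM.search_succ, ifZero]
    split_ifs with hβ
    · exact ⟨hM.monus_self _, hβ⟩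
    -- As `β` does not vanish at `k`, the zero `i` lies strictly below `k`, and the search value is
    -- unchanged.
    · have hik := (hM.eq_or_succ_monus h).resolve_left (by rintro rfl; exact hβ hi')
      refine ⟨?_, (hk hik).2⟩
      rw [hM.monus_succ]
      exact (congrArg pred (hk hik).1).trans hM.pred_zero

end IsModel

end NSA

namespace NSA

/-! ### Terms coding assignments by sequences of type-two objects -/

section TupleTerms

variable {Γ : Ctx}

/-- The fourth variable. -/
abbrev v3 {σ τ ρ υ : Ty} : Term (υ :: ρ :: τ :: σ :: Γ) σ :=
  Term.var (Var.succ (Var.succ (Var.succ Var.zero)))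

/-- The fifth variable. -/
abbrev v4 {σ τ ρ υ α : Ty} : Term (α :: υ :: ρ :: τ :: σ :: Γ) σ :=
  Term.var (Var.succ (Var.succ (Var.succ (Var.succ Var.zero))))

/-- The type of sequences of type-two objects, which code assignments. -/
abbrev Ty.tuple : Ty := Ty.nat ⇒ₜ Ty.two

/-- A number that vanishes if and only if `t` does not. -/
def notT (t : Term Γ Ty.nat) : Term Γ Ty.nat := condT t oneT zeroT

/-- The tuple with first entry `Y`, continued by `x`. -/
def tupleConsT (Y : Term Γ Ty.two) (x : Term Γ Ty.tuple) : Term Γ Ty.tuple :=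
  Term.abs (Term.abs (condT v1 (Term.app Y.wk.wk v0) (Term.app (Term.app x.wk.wk (predT v1)) v0)))

/-- The first entry of a tuple. -/
abbrev tupleHeadT (x : Term Γ Ty.tuple) : Term Γ Ty.two := Term.app x zeroT

/-- All but the first entry of a tuple. -/
def tupleTailT (x : Term Γ Ty.tuple) : Term Γ Ty.tuple := Term.abs (Term.app x.wk (succT v0))

/-- The code of a type-one object as a type-two object. -/
def embedT (f : Term Γ Ty.one) : Term Γ Ty.two := Term.abs (Term.app f.wk (Term.app v0 zeroT))

/-- The type-one object with a given code. -/
def decodeT (Y : Term Γ Ty.two) : Term Γ Ty.one := Term.abs (Term.app Y.wk (Term.abs v1))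

end TupleTerms

namespace PreModel

variable {M : PreModel} {Γ : Ctx}

theorem ifZero_zero (a b : M.C Ty.nat) : ifZero M.zero a b = a := if_pos rfl

/-- Extend a family of functionals by a value for one new variable. -/
def consFamily {ρ σ : Ty} (a : M.C (ρ ⇒ₜ σ)) (d : ∀ τ, Var Γ τ → M.C (ρ ⇒ₜ τ)) :
    ∀ τ, Var (σ :: Γ) τ → M.C (ρ ⇒ₜ τ)
  | _, Var.zero => a
  | _, Var.succ x => d _ x

theorem st_consFamily {ρ σ : Ty} {a : M.C (ρ ⇒ₜ σ)} {d : ∀ τ, Var Γ τ → M.C (ρ ⇒ₜ τ)}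
    (ha : M.st a) (hd : ∀ τ x, M.st (d τ x)) (τ : Ty) (x : Var (σ :: Γ) τ) :
    M.st (consFamily a d τ x) := by
  cases x with
  | zero => exact ha
  | succ x => exact hd _ x

theorem app_consFamily {ρ σ : Ty} (a : M.C (ρ ⇒ₜ σ)) (d : ∀ τ, Var Γ τ → M.C (ρ ⇒ₜ τ))
    (z : M.C ρ) : (fun τ x => M.app (consFamily a d τ x) z) =
      Env.cons (M.app a z) (fun τ x => M.app (d τ x) z) := by
  funext τ x
  cases x <;> rfl

end PreModel

namespace IsModel

open PreModel

variable {M : PreModel} (hM : IsModel M) {Γ : Ctx}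

section

include hM

theorem ifZero_succ (n a b : M.C Ty.nat) : ifZero (succ n) a b = b := if_neg (hM.succ_ne_zero n)

/-! ## Choice and idealisation in models -/

theorem idealisation {σ τ : Ty} (e : M.Env Γ) (φ : Formula (σ :: τ :: Γ)) (hφ : φ.Internal)
    (h : ∀ w : M.C (Ty.seq σ), M.st w → ∃ y : M.C τ, ∀ i, monus (succ i) (len w) = M.zero →
      M.Sat (Env.cons (entry w i) (Env.cons y e)) φ) :
    ∃ y : M.C τ, ∀ x : M.C σ, M.st x → M.Sat (Env.cons x (Env.cons y e)) φ := by
  have := hM.sat (.idealisation σ τ φ hφ) e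
  simp only [sat_imp, sat_allSt, sat_ex, sat_all, hM.sat_mem, sat_subst, eval_lift,
    eval_var_succ, eval_v0] at this
  refine this fun w hw => ?_
  obtain ⟨y, hy⟩ := h w hw
  refine ⟨y, ?_⟩
  rintro _ ⟨i, hi, rfl⟩
  exact hy i hi

/-- The index `i` is not asserted to be standard, hence neither is the chosen entry; applications
have to allow for this. -/
theorem choice {ρ τ : Ty} (e : M.Env Γ) (φ : Formula (τ :: ρ :: Γ)) (hφ : φ.Internal)
    (h : ∀ x : M.C ρ, M.st x → ∃ y : M.C τ, M.st y ∧ M.Sat (Env.cons y (Env.cons x e)) φ) :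
    ∃ F : M.C (ρ ⇒ₜ Ty.seq τ), M.st F ∧ ∀ x, M.st x → ∃ i,
      monus (succ i) (len (M.app F x)) = M.zero ∧
        M.Sat (Env.cons (entry (M.app F x) i) (Env.cons x e)) φ := by
  have := hM.sat (.hacInt ρ τ φ hφ) e
  simp only [sat_imp, sat_allSt, sat_exSt, sat_ex, sat_and, hM.sat_mem, sat_subst,
    eval_lift, eval_app, eval_var_succ, eval_v0] at this
  obtain ⟨F, hF, hF'⟩ := this h
  refine ⟨F, hF, fun x hx => ?_⟩
  obtain ⟨_, ⟨i, hi, rfl⟩, hy⟩ := hF' x hx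
  exact ⟨i, hi, hy⟩

theorem eval_notT_eq_zero_iff (e : M.Env Γ) (t : Term Γ Ty.nat) :
    M.eval e (notT t) = M.zero ↔ M.eval e t ≠ M.zero := by
  rw [notT, hM.eval_condT, ifZero]
  split_ifs with h
  · exact iff_of_false (hM.succ_ne_zero M.zero) (not_not.2 h)
  · exact iff_of_true rfl h

/-! ## Coding of assignments -/

theorem eval_tupleConsT_app_zero (e : M.Env Γ) (Y : Term Γ Ty.two) (x : Term Γ Ty.tuple) :
    M.app (M.eval e (tupleConsT Y x)) (M.con Const.zero) = M.eval e Y := by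
  refine hM.funext fun g => ?_
  simp only [tupleConsT, hM.app_eval_abs, hM.eval_condT]
  exact (if_pos rfl).trans (by simp)

/-- The tuple may be given by any term with the right value, because in applications it is the value
of a variable. -/
theorem eval_tupleTailT_of_eq {Δ : Ctx} {e : M.Env Γ} {e' : M.Env Δ} {t : Term Δ Ty.tuple}
    {Y : Term Γ Ty.two} {x : Term Γ Ty.tuple} (h : M.eval e' t = M.eval e (tupleConsT Y x)) :
    M.eval e' (tupleTailT t) = M.eval e x := by
  refine hM.funext fun n => hM.funext fun g => ?_
  simp only [tupleTailT, hM.app_eval_abs, eval_app, eval_wk, h]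
  simp only [tupleConsT, hM.app_eval_abs, hM.eval_condT]
  refine (if_neg (hM.succ_ne_zero n)).trans ?_
  simp only [eval_app, eval_wk, eval_predT, eval_var_succ, eval_v0, eval_con]
  exact congrArg (fun m => M.app (M.app (M.eval e x) m) g) (hM.pred_succ n)

/-- Every standard object of type `0` or `1` is decoded from a standard type-one object. -/
theorem exists_st_decode {σ : Ty} (hσ : σ = Ty.nat ∨ σ = Ty.one) :
    ∃ p : M.C (Ty.two ⇒ₜ σ), M.st p ∧ ∀ a : M.C σ, M.st a →
      ∃ f : M.C Ty.one, M.st f ∧ M.app p (M.eval (Env.cons f Env.nil) (embedT v0)) = a := by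
  rcases hσ with rfl | rfl
  · refine ⟨M.eval Env.nil (Term.abs (Term.app v0 (Term.abs zeroT))), hM.st_eval st_nil _,
      fun a ha => ⟨M.eval (Env.cons a Env.nil) (Term.abs v1),
        hM.st_eval (st_cons ha st_nil) _, ?_⟩⟩
    simp [embedT, hM.app_eval_abs]
  · refine ⟨M.eval Env.nil (Term.abs (decodeT v0)), hM.st_eval st_nil _,
      fun a ha => ⟨a, ha, hM.funext fun n => ?_⟩⟩
    simp [embedT, decodeT, hM.app_eval_abs]

/-- Terms are represented by standard functionals of the assignment. -/
theorem exists_st_eval {ρ : Ty} (d : ∀ τ, Var Γ τ → M.C (ρ ⇒ₜ τ)) (hd : ∀ τ x, M.st (d τ x))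
    {τ : Ty} (t : Term Γ τ) :
    ∃ S : M.C (ρ ⇒ₜ τ), M.st S ∧ ∀ x, M.app S x = M.eval (fun τ v => M.app (d τ v) x) t := by
  induction t with
  | var v => exact ⟨d _ v, hd _ v, fun _ => rfl⟩
  | con c =>
    exact ⟨M.eval Env.nil (Term.abs (Term.con c)), hM.st_eval st_nil _,
      fun x => by simp [hM.app_eval_abs]⟩
  | app f t hf ht =>
    obtain ⟨F, hF, hF'⟩ := hf
    obtain ⟨S, hS, hS'⟩ := ht
    exact ⟨M.eval (Env.cons F (Env.cons S Env.nil)) (Term.abs (Term.app (Term.app v1 v0)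
      (Term.app v2 v0))), hM.st_eval (st_cons hF (st_cons hS st_nil)) _,
      fun x => by simp [hM.app_eval_abs, hF', hS']⟩

end

/-! ## Deciding formulas by standard functionals -/

variable (hSOT : ∀ Y : M.C Ty.two, M.st Y → (∃ f, M.app Y f = M.zero) →
  ∃ f, M.st f ∧ M.app Y f = M.zero)
include hM hSOT

/-- Contrapositive of `SOT`, for the standard functional that vanishes exactly where `Y` does not.
-/
theorem forall_eq_zero_of_forall_st {Y : M.C Ty.two} (hY : M.st Y)
    (h : ∀ f, M.st f → M.app Y f = M.zero) (f : M.C Ty.one) : M.app Y f = M.zero := by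
  by_contra hf
  have key : ∀ g, M.app (M.eval (Env.cons Y Env.nil) (Term.abs (notT (Term.app v1 v0)))) g =
      M.zero ↔ M.app Y g ≠ M.zero := fun g => by
    rw [hM.app_eval_abs, hM.eval_notT_eq_zero_iff]
    rfl
  obtain ⟨g, hg, hg'⟩ := hSOT _ (hM.st_eval (st_cons hY st_nil) _) ⟨f, (key f).2 hf⟩
  exact (key g).1 hg' (h g hg)

/-- Quantification over standard type-one objects is decided by a standard functional. -/
theorem exists_st_forall {ρ : Ty} {E : M.C (ρ ⇒ₜ Ty.one ⇒ₜ Ty.nat)} (hE : M.st E) :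
    ∃ E' : M.C (ρ ⇒ₜ Ty.nat), M.st E' ∧ ∀ x, M.st x →
      (M.app E' x = M.zero ↔ ∀ f, M.st f → M.app (M.app E x) f = M.zero) := by
  -- The chosen `y` is a critical point: if `E x` vanishes at `y`, it vanishes everywhere. The inner
  -- quantifier ranges over all `f` because choice needs an internal formula; `SOT` bridges the gap
  -- to standard `f`.
  obtain ⟨F, hF, hF'⟩ := hM.choice (ρ := ρ) (τ := Ty.one) (Env.cons E Env.nil)
    (Formula.imp (Formula.eq0 (Term.app (Term.app v2 v1) v0) zeroT)
      (Formula.all Ty.one (Formula.eq0 (Term.app (Term.app v3 v2) v0) zeroT)))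
    ⟨trivial, trivial⟩ (fun x hx => by
      simp only [sat_imp, sat_all, hM.sat_eq0, eval_app, eval_var_succ, eval_v0, eval_con]
      by_cases h : ∀ f, M.app (M.app E x) f = M.zero
      · obtain ⟨y, hy⟩ := hM.exists_st Ty.one
        exact ⟨y, hy, fun _ => h⟩
      · obtain ⟨y, hy, hy'⟩ : ∃ y, M.st y ∧ M.app (M.app E x) y ≠ M.zero := by
          by_contra! h'
          exact h (hM.forall_eq_zero_of_forall_st hSOT (hM.st_app hE hx) h')
        exact ⟨y, hy, fun h => absurd h hy'⟩)
  simp only [sat_imp, sat_all, hM.sat_eq0, eval_app, eval_var_succ, eval_v0, eval_con] at hF'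
  -- `E'` vanishes iff `E x` vanishes at every entry of `F x`; testing all entries removes the need
  -- to know which one is critical.
  refine ⟨M.eval (Env.cons F (Env.cons E Env.nil)) (Term.abs (notT (boundedExT
    (lenT (Term.app v1 v0)) (Term.abs (notT (Term.app (Term.app v3 v1)
      (entryT (Term.app v2 v1) v0))))))), hM.st_eval (st_cons hF (st_cons hE st_nil)) _,
    fun x hx => ?_⟩
  rw [hM.app_eval_abs, hM.eval_notT_eq_zero_iff, Ne, hM.eval_boundedExT_eq_zero_iff]
  simp only [hM.app_eval_abs, hM.eval_notT_eq_zero_iff, eval_app, eval_var_succ, eval_v0, eval_con,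
    not_exists, not_and, not_not]
  constructor
  · intro h f _
    obtain ⟨i, hi, hi'⟩ := hF' x hx
    exact hi' (h i hi) f
  -- The entry may be nonstandard, so the hypothesis on standard `f` is transferred to all `f`.
  · intro h i _
    exact hM.forall_eq_zero_of_forall_st hSOT (hM.st_app hE hx) h _

/-- Formulas whose quantifiers range over objects of type `0` and `1` are decided by standard
functionals. -/
theorem exists_st_decision (θ : Formula Γ) (hθ : θ.LowerQuantifiers)
    (d : ∀ τ, Var Γ τ → M.C (Ty.tuple ⇒ₜ τ)) (hd : ∀ τ x, M.st (d τ x)) :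
    ∃ E : M.C (Ty.tuple ⇒ₜ Ty.nat), M.st E ∧ ∀ x, M.st x →
      (M.Sat (fun τ v => M.app (d τ v) x) θ.relSt ↔ M.app E x = M.zero) := by
  induction θ with
  | eq0 s t =>
    obtain ⟨S, hS, hS'⟩ := hM.exists_st_eval d hd s
    obtain ⟨T, hT, hT'⟩ := hM.exists_st_eval d hd t
    refine ⟨M.eval (Env.cons S (Env.cons T Env.nil)) (Term.abs (eqT (Term.app v1 v0)
      (Term.app v2 v0))), hM.st_eval (st_cons hS (st_cons hT st_nil)) _, fun x _ => ?_⟩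
    rw [hM.app_eval_abs, hM.eval_eqT_eq_zero_iff, Formula.relSt, hM.sat_eq0, ← hS', ← hT']
    rfl
  | st t => exact hθ.elim
  | fal =>
    refine ⟨M.eval Env.nil (Term.abs oneT), hM.st_eval st_nil _, fun x _ => ?_⟩
    rw [hM.app_eval_abs]
    exact iff_of_false id (hM.succ_ne_zero M.zero)
  | imp φ ψ hφ hψ =>
    obtain ⟨E₁, hE₁, h₁⟩ := hφ hθ.1 d hd
    obtain ⟨E₂, hE₂, h₂⟩ := hψ hθ.2 d hd
    refine ⟨M.eval (Env.cons E₁ (Env.cons E₂ Env.nil)) (Term.abs (condT (Term.app v1 v0)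
      (Term.app v2 v0) zeroT)), hM.st_eval (st_cons hE₁ (st_cons hE₂ st_nil)) _,
      fun x hx => ?_⟩
    rw [hM.app_eval_abs, hM.eval_condT, Formula.relSt, sat_imp, h₁ x hx, h₂ x hx]
    simp only [eval_app, eval_var_succ, eval_v0, eval_con, ifZero]
    split_ifs with h
    · simp [h]
    · simp only [h, false_imp_iff, true_iff]
      rfl
  | all σ φ ih =>
    obtain ⟨p, hp, hp'⟩ := hM.exists_st_decode hθ.1
    -- The new variable is read from the first entry of the tuple, the older ones from its tail.
    obtain ⟨E₀, hE₀, h₀⟩ := ih hθ.2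
      (consFamily (M.eval (Env.cons p Env.nil) (Term.abs (Term.app v1 (tupleHeadT v0))))
        fun τ v => M.eval (Env.cons (d τ v) Env.nil) (Term.abs (Term.app v1 (tupleTailT v0))))
      (st_consFamily (hM.st_eval (st_cons hp st_nil) _)
        fun τ v => hM.st_eval (st_cons (hd τ v) st_nil) _)
    -- The quantifier over type `σ` becomes one over codes `f¹` prepended to the tuple; decoding
    -- reaches every standard object of type `σ`.
    obtain ⟨E', hE', h'⟩ := hM.exists_st_forall hSOT (ρ := Ty.tuple)
      (hM.st_eval (st_cons hE₀ st_nil)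
        (Term.abs (Term.abs (Term.app v2 (tupleConsT (embedT v0) v1)))))
    refine ⟨E', hE', fun x hx => ?_⟩
    have key : ∀ f, M.st f → (M.app (M.app (M.eval (Env.cons E₀ Env.nil) (Term.abs (Term.abs
        (Term.app v2 (tupleConsT (embedT v0) v1))))) x) f = M.zero ↔
        M.Sat (Env.cons (M.app p (M.eval (Env.cons f Env.nil) (embedT v0)))
          (fun τ v => M.app (d τ v) x)) φ.relSt) := by
      intro f hf
      rw [hM.app_eval_abs, hM.app_eval_abs, eval_app]
      refine (h₀ _ (hM.st_eval (st_cons hf (st_cons hx (st_cons hE₀ st_nil))) _)).symm.trans ?_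
      rw [app_consFamily]
      refine iff_of_eq (congrArg (M.Sat · φ.relSt) (congrArg₂ Env.cons ?_ ?_))
      · rw [hM.app_eval_abs]
        simp only [eval_app, eval_var_succ, eval_v0, eval_con, hM.eval_tupleConsT_app_zero]
        rfl
      · refine _root_.funext fun τ => _root_.funext fun v => ?_
        rw [hM.app_eval_abs, eval_app, hM.eval_tupleTailT_of_eq (eval_v0 _ _)]
        rfl
    rw [h' x hx, Formula.relSt, sat_allSt]
    constructor
    · intro h f hf
      exact (key f hf).2 (h _ (hM.st_app hp (hM.st_eval (st_cons hf st_nil) _)))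
    · intro h a ha
      obtain ⟨f, hf, rfl⟩ := hp' a ha
      exact (key f hf).1 (h f hf)

/-- Equality of standard type-one objects is decided by a standard functional. -/
theorem exists_st_decidable_eq : ∃ D : M.C (Ty.one ⇒ₜ Ty.one ⇒ₜ Ty.nat), M.st D ∧
    (∀ f, M.app (M.app D f) f = M.zero) ∧
    ∀ f g, M.st f → M.st g → M.app (M.app D f) g = M.zero → f = g := by
  -- A pair is coded as `x` with components `x(0)` and `x(1)`, and the number quantifier in
  -- pointwise equality is simulated by the values `f(0)`.
  obtain ⟨E, hE, hE'⟩ := hM.exists_st_forall hSOT (ρ := Ty.nat ⇒ₜ Ty.one)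
    (hM.st_eval st_nil (Term.abs (Term.abs (eqT
      (Term.app (Term.app v1 zeroT) (Term.app v0 zeroT))
      (Term.app (Term.app v1 oneT) (Term.app v0 zeroT))))))
  simp only [hM.app_eval_abs, hM.eval_eqT_eq_zero_iff, eval_app, eval_var_succ, eval_v0,
    eval_con] at hE'
  let D := M.eval (Env.cons E Env.nil) (Term.abs (Term.abs (Term.app v2 (Term.abs (Term.abs
    (condT v1 (Term.app v3 v0) (Term.app v2 v0)))))))
  have hD : M.st D := hM.st_eval (st_cons hE st_nil) _
  have key : ∀ f g, M.st f → M.st g → (M.app (M.app D f) g = M.zero ↔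
      ∀ h : M.C Ty.one, M.st h →
        M.app f (M.app h (M.con Const.zero)) = M.app g (M.app h (M.con Const.zero))) := by
    intro f g hf hg
    simp only [D, hM.app_eval_abs, eval_app, eval_var_succ, eval_v0]
    rw [hE' _ (hM.st_eval (st_cons hg (st_cons hf (st_cons hE st_nil))) _)]
    simp only [hM.app_eval_abs, hM.eval_condT, eval_app, eval_var_succ, eval_v0]
    refine forall₂_congr fun h _ => ?_
    exact iff_of_eq (congrArg₂ _ (ifZero_zero _ _) (hM.ifZero_succ M.zero _ _))
  have hrefl : ∀ f, M.st f → M.app (M.app D f) f = M.zero := fun f hf =>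
    (key f f hf hf).2 fun _ _ => rfl
  refine ⟨D, hD, fun f => ?_, fun f g hf hg h => ?_⟩
  -- Reflexivity is transferred to all `f`, since separation applies it to entries at possibly
  -- nonstandard indices.
  · have := hM.forall_eq_zero_of_forall_st hSOT (hM.st_eval (st_cons hD st_nil)
      (Term.abs (Term.app (Term.app v1 v0) v0))) (fun f hf => ?_) f
    · simpa only [hM.app_eval_abs, eval_app, eval_var_succ, eval_v0] using this
    · simpa only [hM.app_eval_abs, eval_app, eval_var_succ, eval_v0] using hrefl f hf
  -- Transfer yields agreement at `f(0)` for every `f`; constant functions then reach every number.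
  · have := hM.forall_eq_zero_of_forall_st hSOT
      (hM.st_eval (st_cons hf (st_cons hg st_nil)) (Term.abs (eqT
        (Term.app v1 (Term.app v0 zeroT)) (Term.app v2 (Term.app v0 zeroT))))) (fun h' hh' => ?_)
    · refine hM.funext fun n => ?_
      have hn := this (M.eval (Env.cons n Env.nil) (Term.abs v1))
      rw [hM.app_eval_abs, hM.eval_eqT_eq_zero_iff] at hn
      simpa only [hM.app_eval_abs, eval_app, eval_var_succ, eval_v0] using hn
    · rw [hM.app_eval_abs, hM.eval_eqT_eq_zero_iff]
      exact (key f g hf hg).1 h h' hh'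

/-! ## Separation -/

/-- Separation of disjoint projections of standard sets on standard arguments. -/
theorem exists_st_separation
    (hSTP : ∀ Y : M.C Ty.two, (∀ f, monus (M.app Y f) (succ M.zero) = M.zero) →
      ∃ Z : M.C Ty.two, M.st Z ∧ ∀ g, M.st g → M.app Z g = M.app Y g)
    {ρ : Ty} {E₁ E₂ : M.C (ρ ⇒ₜ Ty.nat)} {P : M.C (ρ ⇒ₜ Ty.one)} (h₁ : M.st E₁) (h₂ : M.st E₂)
    (hP : M.st P) (h : ∀ a b, M.st a → M.st b → M.app E₁ a = M.zero → M.app E₂ b = M.zero →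
      M.app P a ≠ M.app P b) :
    ∃ Z : M.C Ty.two, M.st Z ∧ ∀ a, M.st a →
      (M.app E₁ a = M.zero → M.app Z (M.app P a) = succ M.zero) ∧
      (M.app E₂ a = M.zero → M.app Z (M.app P a) = M.zero) := by
  obtain ⟨D, hD, hD₁, hD₂⟩ := hM.exists_st_decidable_eq hSOT
  -- The entries are not known to be standard, so `h` does not apply directly. A bad pair `(i, j)`
  -- gives a zero of a standard type-two functional at a function with values `i` and `j`; `SOT`
  -- turns it into a standard bad pair, contradicting `h`.
  have hdisj : ∀ (w : M.C (Ty.seq ρ)), M.st w → ∀ i j, M.app E₁ (entry w i) = M.zero →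
      M.app E₂ (entry w j) = M.zero →
      M.app (M.app D (M.app P (entry w j))) (M.app P (entry w i)) ≠ M.zero := by
    intro w hw i j hi hj hD₀
    let Y := M.eval (Env.cons w (Env.cons E₁ (Env.cons E₂ (Env.cons P (Env.cons D Env.nil)))))
      (Term.abs (addT (Term.app v2 (entryT v1 (Term.app v0 zeroT)))
        (addT (Term.app v3 (entryT v1 (Term.app v0 oneT)))
          (Term.app (Term.app (Term.var (.succ (.succ (.succ (.succ (.succ .zero))))))
            (Term.app v4 (entryT v1 (Term.app v0 oneT))))
            (Term.app v4 (entryT v1 (Term.app v0 zeroT)))))))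
    have hY : ∀ g, M.app Y g = M.zero ↔ M.app E₁ (entry w (M.app g M.zero)) = M.zero ∧
        M.app E₂ (entry w (M.app g (succ M.zero))) = M.zero ∧
        M.app (M.app D (M.app P (entry w (M.app g (succ M.zero)))))
          (M.app P (entry w (M.app g M.zero))) = M.zero := by
      intro g
      simp only [Y, hM.app_eval_abs, hM.eval_addT_eq_zero_iff]
      rfl
    obtain ⟨g, hg, hg'⟩ := hSOT Y (hM.st_eval (st_cons hw (st_cons h₁ (st_cons h₂
      (st_cons hP (st_cons hD st_nil))))) _)
      ⟨M.eval (Env.cons i (Env.cons j Env.nil)) (Term.abs (condT v0 v1 v2)), by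
        rw [hY]
        simp only [hM.app_eval_abs, hM.eval_condT, eval_var_succ, eval_v0, ifZero_zero,
          hM.ifZero_succ]
        exact ⟨hi, hj, hD₀⟩⟩
    obtain ⟨h₁', h₂', h₃'⟩ := (hY g).1 hg'
    have hst : ∀ n : M.C Ty.nat, M.st n → M.st (entry w (M.app g n)) := fun n hn =>
      hM.st_app (hM.st_app (hM.st_con _) hw) (hM.st_app hg hn)
    have ha := hst M.zero (hM.st_con _)
    have hb := hst (succ M.zero) (hM.st_app (hM.st_con _) (hM.st_con _))
    exact h _ _ ha hb h₁' h₂' (hD₂ _ _ (hM.st_app hP hb) (hM.st_app hP ha) h₃').symm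
  -- The bound `Y ≤ 1` does not depend on the point but is put into the idealised formula, so that
  -- `STP2` applies to the resulting `Y`.
  obtain ⟨Y, hY⟩ := hM.idealisation (σ := ρ) (τ := Ty.two)
    (Env.cons E₁ (Env.cons E₂ (Env.cons P Env.nil)))
    (Formula.and (Formula.all Ty.one (Formula.le (Term.app v2 v0) oneT))
      (Formula.and
        (Formula.imp (Formula.eq0 (Term.app v2 v0) zeroT)
          (Formula.eq0 (Term.app v1 (Term.app v4 v0)) oneT))
        (Formula.imp (Formula.eq0 (Term.app v3 v0) zeroT)
          (Formula.eq0 (Term.app v1 (Term.app v4 v0)) zeroT))))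
    (by simp [Formula.Internal, Formula.and, Formula.neg, Formula.le]) (fun w hw => by
      simp only [sat_and, sat_all, sat_imp, hM.sat_le, hM.sat_eq0, eval_app, eval_var_succ,
        eval_v0, eval_con]
      -- The images of the entries of `w` where `E₁` vanishes, with `D` in place of equality;
      -- bounded search then computes the characteristic function.
      let B : M.C Ty.one → Prop := fun f => ∃ i, monus (succ i) (len w) = M.zero ∧
        M.app E₁ (entry w i) = M.zero ∧ M.app (M.app D f) (M.app P (entry w i)) = M.zero
      let Y := M.eval (Env.cons w (Env.cons E₁ (Env.cons P (Env.cons D Env.nil))))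
        (Term.abs (condT (boundedExT (lenT v1) (Term.abs (addT (Term.app v3 (entryT v2 v0))
          (Term.app (Term.app (Term.var (.succ (.succ (.succ (.succ (.succ .zero)))))) v1)
            (Term.app v4 (entryT v2 v0)))))) oneT zeroT))
      have hY : ∀ f, (B f → M.app Y f = succ M.zero) ∧ (¬ B f → M.app Y f = M.zero) := by
        intro f
        have hB : M.eval (Env.cons f (Env.cons w (Env.cons E₁ (Env.cons P (Env.cons D Env.nil)))))
            (boundedExT (lenT v1) (Term.abs (addT (Term.app v3 (entryT v2 v0))
              (Term.app (Term.app (Term.var (.succ (.succ (.succ (.succ (.succ .zero)))))) v1)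
                (Term.app v4 (entryT v2 v0)))))) = M.zero ↔ B f := by
          rw [hM.eval_boundedExT_eq_zero_iff]
          simp only [hM.app_eval_abs, hM.eval_addT_eq_zero_iff]
          rfl
        simp only [Y, hM.app_eval_abs, hM.eval_condT, ifZero]
        exact ⟨fun h => if_pos (hB.2 h), fun h => if_neg (mt hB.1 h)⟩
      refine ⟨Y, fun i hi => ⟨fun f => ?_, fun h => (hY _).1 ⟨i, hi, h, hD₁ _⟩,
        fun h => (hY _).2 ?_⟩⟩
      · by_cases hf : B f
        · rw [(hY f).1 hf]
          exact hM.monus_self _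
        · rw [(hY f).2 hf]
          exact (hM.monus_succ _ _).trans ((congrArg pred (hM.monus_zero _)).trans hM.pred_zero)
      · rintro ⟨j, -, hj, hj'⟩
        exact hdisj w hw j i hj h hj')
  simp only [sat_and, sat_all, sat_imp, hM.sat_le, hM.sat_eq0, eval_app, eval_var_succ,
    eval_v0, eval_con] at hY
  -- Any standard point serves to extract the bound `Y ≤ 1`.
  obtain ⟨a₀, ha₀⟩ := hM.exists_st ρ
  obtain ⟨Z, hZ, hZY⟩ := hSTP Y (hY a₀ ha₀).1
  refine ⟨Z, hZ, fun a ha => ?_⟩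
  rw [hZY _ (hM.st_app hP ha)]
  exact (hY a ha).2

end IsModel

/-! ### Relativised `Σ²₁`-formulas as projections, and the main theorem -/

open PreModel

/-- A lifted substitution fixes the bound variable, so the guard `st v0` is unchanged. -/
theorem Formula.relSt_subst {Γ Δ : Ctx} (s : Subst Γ Δ) (φ : Formula Γ) :
    (φ.subst s).relSt = φ.relSt.subst s := by
  induction φ generalizing Δ with
  | eq0 t u => rfl
  | st t => rfl
  | fal => rfl
  | imp φ ψ hφ hψ => simp only [Formula.subst, Formula.relSt, hφ, hψ]
  | all σ φ ih => simp only [Formula.subst, Formula.relSt, Formula.allSt, ih]; rfl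

/-- Relativising the closure restricts the parameters to standard values. -/
theorem PreModel.sat_relSt_closure {M : PreModel} {Γ : Ctx} {φ : Formula Γ}
    (h : ∀ e : M.Env Γ, (∀ τ x, M.st (e τ x)) → M.Sat e φ.relSt) :
    M.Sat Env.nil (Formula.closure Γ φ).relSt := by
  induction Γ with
  | nil => exact h _ st_nil
  | cons σ Γ ih => exact ih fun e he a ha => h _ (st_cons ha he)

/-- The relativisation of a `Σ²₁`-formula at a standard object is decided by a standard
functional of a code of the witness and the object. -/
theorem IsModel.exists_st_sigma21 {M : PreModel} (hM : IsModel M)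
    (hSOT : ∀ Y : M.C Ty.two, M.st Y → (∃ f, M.app Y f = M.zero) →
      ∃ f, M.st f ∧ M.app Y f = M.zero) {Γ : Ctx} {e : M.Env Γ} (he : ∀ τ x, M.st (e τ x))
    {φ : Formula (Ty.one :: Γ)} (hφ : φ.IsSigma21) :
    ∃ E : M.C (Ty.tuple ⇒ₜ Ty.nat), M.st E ∧ ∀ f, M.st f →
      (M.Sat (Env.cons f e) φ.relSt ↔ ∃ z, M.st z ∧ M.app E z = M.zero ∧
        M.app (M.eval Env.nil (Term.abs (decodeT (tupleHeadT (tupleTailT v0))))) z = f) := by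
  obtain ⟨θ, hθ, rfl⟩ := hφ
  -- In an argument `z`, entry 0 is the witness and entry 1 codes `f`; `P` recovers `f`. Parameters
  -- enter as constant functionals, so their types are arbitrary.
  set P := M.eval Env.nil (Term.abs (decodeT (tupleHeadT (tupleTailT v0)))) with hP
  obtain ⟨E, hE, hE'⟩ := hM.exists_st_decision hSOT θ hθ
    (consFamily (M.eval Env.nil (Term.abs (tupleHeadT v0))) (consFamily P
      fun τ x => M.eval (Env.cons (e τ x) Env.nil) (Term.abs v1)))
    (st_consFamily (hM.st_eval st_nil _) (st_consFamily (hM.st_eval st_nil _)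
      fun τ x => hM.st_eval (st_cons (he τ x) st_nil) _))
  refine ⟨E, hE, fun f hf => ?_⟩
  simp only [app_consFamily, hM.app_eval_abs, eval_app, eval_var_succ, eval_v0, eval_con] at hE'
  have hsat : M.Sat (Env.cons f e) (Formula.ex Ty.two θ).relSt ↔
      ∃ Y, M.st Y ∧ M.Sat (Env.cons Y (Env.cons f e)) θ.relSt := by
    change (¬ ∀ Y, M.st Y → ¬ M.Sat (Env.cons Y (Env.cons f e)) θ.relSt) ↔ _
    push Not
    rfl
  rw [hsat]
  constructor
  · rintro ⟨Y, hY, hθY⟩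
    let e' := Env.cons Y (Env.cons f Env.nil)
    -- Entries beyond the first two are irrelevant; a closed default tuple fills them.
    let t : Term [Ty.two, Ty.one] Ty.tuple := tupleConsT (embedT v1) Ty.tuple.defaultTerm
    have hz : M.st (M.eval e' (tupleConsT v0 t)) :=
      hM.st_eval (st_cons hY (st_cons hf st_nil)) _
    have hPz : M.app P (M.eval e' (tupleConsT v0 t)) = f := by
      rw [hP, hM.app_eval_abs]
      refine hM.funext fun n => ?_
      rw [decodeT, hM.app_eval_abs, eval_app, eval_wk, eval_app,
        hM.eval_tupleTailT_of_eq (eval_v0 _ _), eval_con, hM.eval_tupleConsT_app_zero]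
      simp [e', embedT, hM.app_eval_abs]
    refine ⟨_, hz, (hE' _ hz).1 ?_, hPz⟩
    rw [hPz, hM.eval_tupleConsT_app_zero]
    exact hθY
  · rintro ⟨z, hz, hEz, rfl⟩
    exact ⟨_, hM.st_app hz (hM.st_con _), (hE' z hz).2 hEz⟩

end NSA

open NSA NSA.PreModel in
/-- `P₀ + SOT + STP₂` proves every instance, with parameters, of `[Σ²₁-SEP]ˢᵗ`. -/
theorem theorem4p10 (Γ : NSA.Ctx) (φ₁ φ₂ : NSA.Formula (NSA.Ty.one :: Γ))
    (h₁ : φ₁.IsSigma21) (h₂ : φ₂.IsSigma21) :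
    NSA.Derives NSA.P0Axiom [] [NSA.SOT, NSA.STP2]
      (NSA.Formula.closure Γ (NSA.separation φ₁ φ₂)).relSt := by
  refine derives_of_forall_isModel fun M hM hH => sat_relSt_closure fun e he => ?_
  have hSOT : ∀ Y : M.C Ty.two, M.st Y → (∃ f, M.app Y f = M.zero) →
      ∃ f, M.st f ∧ M.app Y f = M.zero := by
    have := hH SOT (by simp)
    simp only [SOT, sat_allSt, sat_imp, sat_ex, sat_exSt, hM.sat_eq0, eval_app, eval_var_succ,
      eval_v0, eval_con] at this
    exact this
  have hSTP : ∀ Y : M.C Ty.two, (∀ f, monus (M.app Y f) (succ M.zero) = M.zero) →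
      ∃ Z : M.C Ty.two, M.st Z ∧ ∀ g, M.st g → M.app Z g = M.app Y g := by
    have := hH STP2 (by simp)
    simp only [STP2, leOne2, approx2, sat_all, sat_allSt, sat_imp, sat_exSt, sat_and, hM.sat_le,
      hM.sat_eq0, eval_app, eval_wk, eval_var_succ, eval_v0, eval_con] at this
    intro Y hY
    obtain ⟨Z, hZ, -, hZY⟩ := this Y hY
    exact ⟨Z, hZ, hZY⟩
  obtain ⟨E₁, hE₁, hE₁'⟩ := hM.exists_st_sigma21 hSOT he h₁
  obtain ⟨E₂, hE₂, hE₂'⟩ := hM.exists_st_sigma21 hSOT he h₂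
  set P := M.eval Env.nil (Term.abs (decodeT (tupleHeadT (tupleTailT v0)))) with hP
  have hPst : M.st P := hM.st_eval st_nil _
  change (∀ f, M.st f → M.Sat (Env.cons f e) ((φ₁.neg.or φ₂.neg).relSt)) → _
  intro hdisj
  have hdisj : ∀ f, M.st f → ¬ (M.Sat (Env.cons f e) φ₁.relSt ∧
      M.Sat (Env.cons f e) φ₂.relSt) := fun f hf ⟨ha, hb⟩ => hdisj f hf (fun h => h ha) hb
  -- If `P a = P b`, this common standard value would satisfy both relativised formulas.
  obtain ⟨Z, hZ, hZ'⟩ := hM.exists_st_separation hSOT hSTP hE₁ hE₂ hPst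
    fun a b ha hb ha' hb' hab => hdisj _ (hM.st_app hPst ha)
      ⟨(hE₁' _ (hM.st_app hPst ha)).2 ⟨a, ha, ha', rfl⟩,
        (hE₂' _ (hM.st_app hPst ha)).2 ⟨b, hb, hb', hab.symm⟩⟩
  intro hno
  refine hno Z hZ fun f hf => ?_
  change M.Sat _ (Formula.and (Formula.imp (φ₁.subst Subst.wk.lift).relSt _)
    (Formula.imp (φ₂.subst Subst.wk.lift).relSt _))
  rw [sat_and, sat_imp, sat_imp, Formula.relSt_subst, Formula.relSt_subst, sat_subst, sat_subst,
    eval_lift, Formula.relSt, Formula.relSt, hM.sat_eq0, hM.sat_eq0]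
  refine ⟨fun h => ?_, fun h => ?_⟩
  · obtain ⟨z, hz, hEz, rfl⟩ := (hE₁' f hf).1 h
    exact (hZ' z hz).1 hEz
  · obtain ⟨z, hz, hEz, rfl⟩ := (hE₂' f hf).1 h
    exact (hZ' z hz).2 hEz
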